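/- For a set $X$ write $[X]^{\omega}$ for the set of countably infinite subsets of $X$. For uncountable $X$, a set $C\subseteq[X]^{\omega}$ is \emph{club} if there is $f:[X]^{<\omega}\to X$ such that $C=\{Y\in[X]^{\omega}: f(s)\in Y \text{ for every finite } s\subseteq Y\}$. For a regular cardinal $\theta$, $H(\theta)$ is the structure $(H(\theta),\in,<)$ whose domain is the collection of sets with transitive closure of size less than $\theta$, where $<$ is a fixed well ordering of $H(\theta)$. A set $U\subseteq[X]^{\omega}$ is \emph{Ellentuck open} if it is a union of sets of the form $[x,N]=\{Y\in[X]^{\omega}: x\subseteq Y\subseteq N\}$ with $N\in[X]^{\omega}$ and $x\subseteq N$ finite. If $M\prec H(\theta)$ is countable and $[X]^\omega\in M$, a set $S\subseteq[X]^{\omega}$ is \emph{$M$-stationary} if $S\cap E\cap M\neq\emptyset$ for every $E\in M$ such that $E\subseteq[X]^{\omega}$ is club. A function $\Sigma$ is an \emph{open stationary set mapping} if there are an uncountable set $X$ and a regular cardinal $\theta$ such that $[X]^{\omega}\in H(\theta)$, the domain of $\Sigma$ is a club in $[H(\theta)]^{\omega}$ consisting of countable elementary submodels $M$ of $H(\theta)$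 with $X\in M$, and for every $M$ in the domain $\Sigma(M)\subseteq[X]^{\omega}$ is Ellentuck open and $M$-stationary. The \emph{Mapping Reflection Principle} $\mathsf{MRP}$ asserts: for every open stationary set mapping $\Sigma$, with witnesses $X$ and $\theta$, there is a continuous $\in$-chain $(N_\xi:\xi<\omega_1)$ of elements of the domain of $\Sigma$ (that is, $N_\xi\in N_\eta$ for $\xi<\eta<\omega_1$, and $N_\xi=\bigcup_{\eta<\xi}N_\eta$ for limit $\xi<\omega_1$) such that for every limit ordinal $\xi<\omega_1$ there is $\nu<\xi$ with $N_\eta\cap X\in\Sigma(N_\xi)$ for all $\eta$ with $\nu<\eta<\xi$. \textbf{Theorem 1.} Assume $\mathsf{MRP}$. Then $\lambda^{\aleph_0}=\lambda$ for every cardinal $\lambda\geq\omega_2$ of uncountable cofinality. -/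

import Mathlib

open Cardinal Ordinal

universe u

namespace MRPFormal

/-! Sets are the elements of `ZFSet.{u}`. A `Set ZFSet.{u}` is a collection of such sets, and a
`ZFSet` is coerced to the collection of its elements. -/

noncomputable section

/-- The transitive closure `x ∪ ⋃₀ x ∪ ⋃₀ ⋃₀ x ∪ …` of a set `x`. -/
def trcl (x : ZFSet.{u}) : ZFSet.{u} := ZFSet.iUnion fun n : ℕ => ZFSet.sUnion^[n] x

/-- `H(θ)`: the sets whose transitive closure has cardinality less than `θ`. -/
def H (θ : Cardinal.{u}) : Set ZFSet.{u} := {x | (trcl x).card < θ}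

/-- The relation symbols of the language of set theory with an additional binary predicate. -/
inductive SetRel : ℕ → Type
  | mem : SetRel 2
  | lt : SetRel 2

/-- The first-order language `{∈, <}`. -/
def setLang : FirstOrder.Language where
  Functions := fun _ => Empty
  Relations := SetRel

/-- The structure `(H(θ), ∈, <)`, where `<` is a fixed well ordering of `H(θ)`. -/
instance structureH (θ : Cardinal.{u}) : setLang.Structure (H θ) where
  funMap := fun f _ => nomatch f
  RelMap := fun {_} R =>
    match R with
    | SetRel.mem => fun v => (v 0 : ZFSet.{u}) ∈ (v 1 : ZFSet.{u})
    | SetRel.lt => fun v => WellOrderingRel (v 0) (v 1)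

/-- `M` is (the domain of) an elementary submodel of `(H(θ), ∈, <)`. -/
def IsElementarySubmodel (θ : Cardinal.{u}) (M : ZFSet.{u}) : Prop :=
  (M : Set ZFSet.{u}) ⊆ H θ ∧
    ∃ S : setLang.ElementarySubstructure (H θ), ∀ y : H θ, y ∈ S ↔ (y : ZFSet.{u}) ∈ M

/-- `[A]^ω`: the countably infinite sets `Y ⊆ A`. -/
def subsetsOmega (A : Set ZFSet.{u}) : Set ZFSet.{u} :=
  {Y | (Y : Set ZFSet.{u}) ⊆ A ∧ Y.card = ℵ₀}

/-- `[X]^ω` as a set, for a set `X`. -/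
def powOmega (X : ZFSet.{u}) : ZFSet.{u} := ZFSet.sep (fun Y => Y.card = ℵ₀) X.powerset

theorem coe_powOmega (X : ZFSet.{u}) : (powOmega X : Set ZFSet.{u}) = subsetsOmega X := by
  ext Y
  simp [powOmega, subsetsOmega]

/-- `C` is club in `[A]^ω`: there is `f : [A]^{<ω} → A` such that `C` consists of all `Y ∈ [A]^ω`
with `f[Y]^{<ω} ⊆ Y`. -/
def IsClub (A C : Set ZFSet.{u}) : Prop :=
  ∃ f : Finset A → A, C = {Y | Y ∈ subsetsOmega A ∧
    ∀ s : Finset A, (∀ a ∈ s, (a : ZFSet.{u}) ∈ Y) → (f s : ZFSet.{u}) ∈ Y}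

/-- `S ⊆ [X]^ω` is `M`-stationary: it meets `E ∩ M` for every `E ∈ M` that is club in `[X]^ω`. -/
def IsStationaryFor (M X : ZFSet.{u}) (S : Set ZFSet.{u}) : Prop :=
  ∀ E ∈ M, IsClub (X : Set ZFSet.{u}) (E : Set ZFSet.{u}) → ∃ Y ∈ S, Y ∈ E ∧ Y ∈ M

/-- The basic Ellentuck set `[x, N] = {Y ∈ [X]^ω : x ⊆ Y ⊆ N}`. -/
def ellentuckBasic (X x N : ZFSet.{u}) : Set ZFSet.{u} :=
  {Y | Y ∈ subsetsOmega (X : Set ZFSet.{u}) ∧ x ⊆ Y ∧ Y ⊆ N}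

/-- `U` is open in the Ellentuck topology on `[X]^ω`: it is a union of sets `[x, N]` with
`N ∈ [X]^ω` and `x ⊆ N` finite. -/
def IsEllentuckOpen (X : ZFSet.{u}) (U : Set ZFSet.{u}) : Prop :=
  ∃ B : Set (Set ZFSet.{u}),
    (∀ b ∈ B, ∃ x N : ZFSet.{u}, N ∈ subsetsOmega (X : Set ZFSet.{u}) ∧ x ⊆ N ∧
      (x : Set ZFSet.{u}).Finite ∧ b = ellentuckBasic X x N) ∧
    U = ⋃₀ B

/-- `S`, with domain `D`, is an open stationary set mapping, as witnessed by `X` and `θ`.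
The values of `S` outside `D` play no role. -/
structure IsOpenStationaryMapping (X : ZFSet.{u}) (θ : Cardinal.{u}) (D : Set ZFSet.{u})
    (S : ZFSet.{u} → Set ZFSet.{u}) : Prop where
  uncountable : ℵ₀ < X.card
  regular : θ.IsRegular
  powOmega_mem : powOmega X ∈ H θ
  club : IsClub (H θ) D
  elementary : ∀ M ∈ D, IsElementarySubmodel θ M
  mem : ∀ M ∈ D, X ∈ M
  subset : ∀ M ∈ D, S M ⊆ subsetsOmega (X : Set ZFSet.{u})
  isOpen : ∀ M ∈ D, IsEllentuckOpen X (S M)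
  stationary : ∀ M ∈ D, IsStationaryFor M X (S M)

/-- `(N ξ : ξ < ω₁)` is a continuous `∈`-chain. -/
def IsContinuousChain (N : Ordinal.{u} → ZFSet.{u}) : Prop :=
  (∀ ξ η : Ordinal.{u}, ξ < η → η < ω₁ → N ξ ∈ N η) ∧
  ∀ ξ : Ordinal.{u}, ξ < ω₁ → Order.IsSuccLimit ξ →
    ∀ y : ZFSet.{u}, y ∈ N ξ ↔ ∃ η < ξ, y ∈ N η

/-- The Mapping Reflection Principle: every open stationary set mapping has a reflecting
sequence. -/
def MRP : Prop :=
  ∀ (X : ZFSet.{u}) (θ : Cardinal.{u}) (D : Set ZFSet.{u}) (S : ZFSet.{u} → Set ZFSet.{u}),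
    IsOpenStationaryMapping X θ D S →
    ∃ N : Ordinal.{u} → ZFSet.{u},
      IsContinuousChain N ∧
      (∀ ξ < ω₁, N ξ ∈ D) ∧
      ∀ ξ < ω₁, Order.IsSuccLimit ξ →
        ∃ ν < ξ, ∀ η, ν < η → η < ξ → N η ∩ X ∈ S (N ξ)

end

end MRPFormal

namespace MRPFormal

/-! Two applications of `MRP` feed an induction on the cardinal `l`. Both go through `reflection`,
which replaces countable elementary submodels by countable subsets of a type `T` closed under
countably many operations.

The first gives 2^ℵ₀ ≤ ℵ₂ by coding each r ⊆ ω by a point of ω₂. Fix a partition of ω₁ into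
stationary sets indexed by ω, and a ladder through every countable set without last element.
`exists_coding_chain` produces a chain whose union is an initial segment u of ω₂. For club many ξ,
the models shortly before stage ξ are low in N_ξ ∩ ω₁ and high in N_ξ, or the reverse, according to
whether the index of the piece containing ξ lies in r. Chains with the same union agree on a club,
so u determines r (`two_power_aleph0_le`).

The second handles κ⁺ for κ of countable cofinality (`succ_power_aleph0_le_of_cof_le`). A covering
matrix exhausts the points up to each β < κ⁺ by sets D n β of size less than κ. If κ⁺ had more than
κ⁺ countable sequences, the entries could not cover all countable subfamilies of an unbounded
family. This makes it stationary for a supremum to avoid a prescribed entry. But along a reflecting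
chain stationarily many suprema fall into a single entry, a contradiction.

In the remaining cases sequences are bounded by uncountable cofinality, and the induction hypothesis
counts the bounded ones. -/

/-! ### Closure under finitary operations -/

theorem countable_setOf_forall_mem_list {A : Type*} {S : Set A} (hS : S.Countable) :
    {l : List A | ∀ a ∈ l, a ∈ S}.Countable := by
  have := hS.to_subtype
  rw [← Set.range_list_map_coe]
  exact Set.countable_range _

theorem exists_countable_closed {A : Type*} (F : List A → A) (Z : Set A) (hZ : Z.Countable) :
    ∃ B : Set A, Z ⊆ B ∧ B.Countable ∧ ∀ l : List A, (∀ a ∈ l, a ∈ B) → F l ∈ B := by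
  let step : Set A → Set A := fun S => S ∪ F '' {l | ∀ a ∈ l, a ∈ S}
  have hstep : ∀ S : Set A, S.Countable → (step S).Countable := fun S hS =>
    hS.union ((countable_setOf_forall_mem_list hS).image F)
  let C : ℕ → Set A := fun n => step^[n] Z
  have hC : ∀ n, C (n + 1) = step (C n) := fun n => Function.iterate_succ_apply' step n Z
  have hmono : Monotone C := monotone_nat_of_le_succ fun n => by
    rw [hC]; exact Set.subset_union_left
  refine ⟨⋃ n, C n, Set.subset_iUnion C 0, Set.countable_iUnion fun n => ?_, fun l hl => ?_⟩
  · induction n with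
    | zero => exact hZ
    | succ n ih => rw [hC]; exact hstep _ ih
  · have : ∃ n, ∀ a ∈ l, a ∈ C n := by
      clear hC
      induction l with
      | nil => exact ⟨0, by simp⟩
      | cons b l ih =>
        obtain ⟨n, hn⟩ := ih fun a ha => hl a (List.mem_cons_of_mem _ ha)
        obtain ⟨m, hm⟩ := Set.mem_iUnion.1 (hl b List.mem_cons_self)
        refine ⟨max n m, fun a ha => ?_⟩
        rcases List.mem_cons.1 ha with rfl | ha
        · exact hmono (le_max_right n m) hm
        · exact hmono (le_max_left n m) (hn a ha)
    obtain ⟨n, hn⟩ := this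
    refine Set.mem_iUnion.2 ⟨n + 1, ?_⟩
    rw [hC]
    exact Or.inr ⟨l, hn, rfl⟩

/-- A finite set forgets order and repetition, so the argument list must be coded. Fix a countably
infinite `B` closed under `F`, enumerated by `a`. On finite subsets of `B`, `f` returns the element
of `B` numbered by their cardinality, which forces B ⊆ Y. On other sets, the part inside `B` serves
only as a number, selecting one of the countably many lists over `B` and the part outside. -/
theorem exists_finset_fun_of_list_fun {A : Type*} [Infinite A] (F : List A → A) :
    ∃ f : Finset A → A, ∀ Y : Set A,
      (∀ s : Finset A, (∀ a ∈ s, a ∈ Y) → f s ∈ Y) →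
        ∀ l : List A, (∀ a ∈ l, a ∈ Y) → F l ∈ Y := by
  classical
  obtain ⟨B, hZB, hBc, hB⟩ := exists_countable_closed F (Set.range (Infinite.natEmbedding A))
    (Set.countable_range _)
  have hBi : B.Infinite := (Set.infinite_range_of_injective
    (Infinite.natEmbedding A).injective).mono hZB
  have := hBi.to_subtype
  have := hBc.to_subtype
  obtain ⟨⟨a⟩⟩ : Nonempty (Nonempty (ℕ ≃ B)) := ⟨nonempty_equiv_of_countable⟩
  have he : ∀ t : Finset A, ∃ e : ℕ → List A, ∀ l : List A, (∀ x ∈ l, x ∈ (t : Set A) ∪ B) →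
      ∃ m, e m = l := by
    intro t
    have hc := countable_setOf_forall_mem_list (t.countable_toSet.union hBc)
    obtain ⟨e, he⟩ := hc.exists_eq_range ⟨[], by simp⟩
    refine ⟨e, fun l hl => ?_⟩
    have : l ∈ Set.range e := he ▸ hl
    exact this
  choose e he using he
  let out : Finset A → Finset A := fun s => s.filter (· ∉ B)
  let inn : Finset A → Finset A := fun s => s.filter (· ∈ B)
  refine ⟨fun s => if out s = ∅ then (a (inn s).card : A) else F (e (out s) (inn s).card),
    fun Y hY => ?_⟩
  let mk : ℕ → Finset A := fun m => (Finset.range m).image fun i => (a i : A)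
  have hcard : ∀ m, (mk m).card = m := fun m => by
    have hinj : Function.Injective fun i => (a i : A) :=
      Subtype.val_injective.comp a.injective
    rw [Finset.card_image_of_injective _ hinj, Finset.card_range]
  have hmkB : ∀ m, ∀ x ∈ mk m, x ∈ B := by
    intro m x hx
    obtain ⟨i, -, rfl⟩ := Finset.mem_image.1 hx
    exact (a i).2
  have haY : ∀ m, (a m : A) ∈ Y := by
    intro m
    induction m using Nat.strong_induction_on with
    | _ m ih =>
      have h1 : ∀ x ∈ mk m, x ∈ Y := by
        intro x hx
        obtain ⟨i, hi, rfl⟩ := Finset.mem_image.1 hx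
        exact ih i (Finset.mem_range.1 hi)
      have h2 := hY (mk m) h1
      have h3 : out (mk m) = ∅ := Finset.filter_eq_empty_iff.2 fun x hx => by
        simpa using hmkB m x hx
      have h4 : inn (mk m) = mk m := Finset.filter_true_of_mem (hmkB m)
      simpa [h3, h4, hcard] using h2
  have hBY : B ⊆ Y := fun x hx => by simpa using haY (a.symm ⟨x, hx⟩)
  intro l hl
  by_cases hlB : ∀ x ∈ l, x ∈ B
  · exact hBY (hB l hlB)
  · let t : Finset A := l.toFinset.filter (· ∉ B)
    have ht : ∀ x ∈ t, x ∈ l ∧ x ∉ B := fun x hx => by simpa [t] using hx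
    obtain ⟨m, hm⟩ := he t l fun x hx => by
      by_cases hxB : x ∈ B
      · exact Or.inr hxB
      · exact Or.inl (by simp [t, hx, hxB])
    have h1 : out (t ∪ mk m) = t := by
      ext x
      simp only [out, Finset.mem_filter, Finset.mem_union]
      exact ⟨fun h => h.1.resolve_right fun h' => h.2 (hmkB m x h'), fun h => ⟨Or.inl h, (ht x h).2⟩⟩
    have h2 : inn (t ∪ mk m) = mk m := by
      ext x
      simp only [inn, Finset.mem_filter, Finset.mem_union]
      exact ⟨fun h => h.1.resolve_left fun h' => (ht x h').2 h.2, fun h => ⟨Or.inr h, hmkB m x h⟩⟩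
    have h3 : t ≠ ∅ := by
      push Not at hlB
      obtain ⟨x, hx, hxB⟩ := hlB
      exact Finset.ne_empty_of_mem (a := x) (by simp [t, hx, hxB])
    have h4 := hY (t ∪ mk m) fun x hx => by
      rcases Finset.mem_union.1 hx with h | h
      · exact hl x (ht x h).1
      · exact hBY (hmkB m x h)
    simpa [h1, h2, h3, hcard, hm] using h4

/-- Countably many finitary operations can be coded by a single function of finite sets. -/
theorem exists_finset_fun {A ι : Type*} [Infinite A] [Countable ι] (F : ι → List A → A) :
    ∃ f : Finset A → A, ∀ Y : Set A, Y.Nonempty →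
      (∀ s : Finset A, (∀ a ∈ s, a ∈ Y) → f s ∈ Y) →
        ∀ i, ∀ l : List A, (∀ a ∈ l, a ∈ Y) → F i l ∈ Y := by
  rcases isEmpty_or_nonempty ι with hι | hι
  · exact ⟨fun _ => Classical.arbitrary A, fun _ _ _ i => isEmptyElim i⟩
  obtain ⟨g, hg⟩ := exists_surjective_nat ι
  -- The length of the list codes both the operation and the number of genuine arguments; the rest
  -- is padding by a point of `Y`.
  obtain ⟨f, hf⟩ := exists_finset_fun_of_list_fun fun l : List A =>
    F (g l.length.unpair.1) (l.take l.length.unpair.2)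
  refine ⟨f, fun Y ⟨y, hy⟩ hY i l hl => ?_⟩
  obtain ⟨j, rfl⟩ := hg i
  have hle : l.length ≤ Nat.pair j l.length := Nat.right_le_pair _ _
  have := hf Y hY (l ++ List.replicate (Nat.pair j l.length - l.length) y) (by
    intro a ha
    rcases List.mem_append.1 ha with h | h
    · exact hl a h
    · rw [List.eq_of_mem_replicate h]; exact hy)
  have hlen : (l ++ List.replicate (Nat.pair j l.length - l.length) y).length
      = Nat.pair j l.length := by
    simp [hle]
  rw [hlen] at this
  simpa using this

/-! ### The structure H(θ) and clubs of elementary submodels -/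

theorem trcl_subset_of_mem {x y : ZFSet.{u}} (h : y ∈ x) : trcl y ⊆ trcl x := by
  intro z hz
  obtain ⟨n, hn⟩ := ZFSet.mem_iUnion.1 hz
  refine ZFSet.mem_iUnion.2 ⟨n + 1, ?_⟩
  rw [Function.iterate_succ_apply]
  have hsub : y ⊆ ZFSet.sUnion x := fun w hw => ZFSet.mem_sUnion_of_mem hw h
  have : ∀ (n : ℕ) (a b : ZFSet.{u}), a ⊆ b → ZFSet.sUnion^[n] a ⊆ ZFSet.sUnion^[n] b := by
    intro n
    induction n with
    | zero => exact fun a b h => h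
    | succ n ih =>
      intro a b h
      rw [Function.iterate_succ_apply, Function.iterate_succ_apply]
      refine ih _ _ fun w hw => ?_
      obtain ⟨v, hv, hwv⟩ := ZFSet.mem_sUnion.1 hw
      exact ZFSet.mem_sUnion_of_mem hwv (h hv)
  exact this n _ _ hsub hn

theorem H_transitive {θ : Cardinal.{u}} {x y : ZFSet.{u}} (hx : x ∈ H θ) (h : y ∈ x) : y ∈ H θ :=
  (ZFSet.card_mono (trcl_subset_of_mem h)).trans_lt hx

theorem card_eq_aleph0_iff {x : ZFSet.{u}} :
    x.card = ℵ₀ ↔ (x : Set ZFSet.{u}).Countable ∧ (x : Set ZFSet.{u}).Infinite := by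
  have h : #((x : Set ZFSet.{u})) = Cardinal.lift.{u + 1, u} x.card := ZFSet.cardinalMk_coe_sort
  rw [← Cardinal.lift_inj.{u, u + 1}, ← h, Cardinal.lift_aleph0, ← Set.countable_coe_iff,
    ← Set.infinite_coe_iff, ← Cardinal.mk_le_aleph0_iff, Cardinal.infinite_iff]
  exact le_antisymm_iff

instance : Countable setLang.Symbols := by
  have h1 : IsEmpty (Σ l, setLang.Functions l) := ⟨fun x => nomatch x.2⟩
  have h2 : Countable (Σ l, setLang.Relations l) := by
    have hs : Function.Surjective
        fun b : Bool => (if b then ⟨2, SetRel.mem⟩ else ⟨2, SetRel.lt⟩ : Σ l, SetRel l) := by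
      rintro ⟨_, _ | _⟩
      · exact ⟨true, rfl⟩
      · exact ⟨false, rfl⟩
    exact hs.countable
  exact instCountableSum

/-- Every countable family of operations on sets has a club of elementary submodels of `H θ` which
are closed under it. -/
theorem exists_isClub_elementary (θ : Cardinal.{u}) [Infinite (H θ)] {ι : Type} [Countable ι]
    (F : ι → List ZFSet.{u} → ZFSet.{u}) :
    ∃ D : Set ZFSet.{u}, IsClub (H θ) D ∧ ∀ M ∈ D, IsElementarySubmodel θ M ∧
      (M : Set ZFSet.{u}).Countable ∧
      ∀ i l, (∀ x ∈ l, x ∈ M) → F i l ∈ H θ → F i l ∈ M := by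
  classical
  have : Inhabited (H θ) := ⟨Classical.arbitrary _⟩
  have : Countable (Σ n, setLang.BoundedFormula Empty (n + 1)) :=
    Function.Injective.countable
      (f := fun x => (⟨x.1 + 1, x.2⟩ : Σ n, setLang.BoundedFormula Empty n)) (by
        rintro ⟨n, φ⟩ ⟨m, ψ⟩ h
        simp only [Sigma.mk.injEq, Nat.add_right_cancel_iff] at h
        obtain ⟨rfl, h⟩ := h
        simpa using h)
  -- Skolem functions; closure under them is the Tarski–Vaught criterion.
  let Sk : (Σ n, setLang.BoundedFormula Empty (n + 1)) → List (H θ) → H θ := fun φ l =>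
    Classical.epsilon fun a =>
      φ.2.Realize (@default _ Unique.instInhabited) (Fin.snoc (fun i : Fin φ.1 => l.getD i default) a : _ → H θ)
  let Fl : ι → List (H θ) → H θ := fun i l =>
    if h : F i (l.map Subtype.val) ∈ H θ then ⟨_, h⟩ else default
  obtain ⟨f, hf⟩ := exists_finset_fun (Sum.elim Sk Fl)
  refine ⟨_, ⟨f, rfl⟩, ?_⟩
  rintro M ⟨⟨hMH, hM⟩, hcl⟩
  obtain ⟨hMc, hMi⟩ := card_eq_aleph0_iff.1 hM
  have hne : {a : H θ | (a : ZFSet) ∈ M}.Nonempty := by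
    obtain ⟨x, hx⟩ := hMi.nonempty
    exact ⟨⟨x, hMH hx⟩, hx⟩
  have hcl' := hf {a : H θ | (a : ZFSet) ∈ M} hne hcl
  refine ⟨⟨hMH, ?_⟩, hMc, ?_⟩
  · let S : setLang.Substructure (H θ) := ⟨{a : H θ | (a : ZFSet) ∈ M}, fun f => nomatch f⟩
    refine ⟨S.toElementarySubstructure fun n φ x a ha => ?_, fun y => Iff.rfl⟩
    have h1 := hcl' (Sum.inl ⟨n, φ⟩) (List.ofFn fun i => (x i : H θ)) (by
      intro b hb
      obtain ⟨i, rfl⟩ := (List.mem_ofFn' _ _).1 hb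
      exact (x i).2)
    have h2 : (fun i : Fin n => (List.ofFn fun i => (x i : H θ)).getD i default)
        = (fun i => (x i : H θ)) := by
      funext i
      simp
    refine ⟨⟨_, h1⟩, ?_⟩
    have h3 := Classical.epsilon_spec (p := fun a : H θ => φ.Realize (@default _ Unique.instInhabited)
      (Fin.snoc (fun i : Fin n => (List.ofFn fun i => (x i : H θ)).getD i default) a : _ → H θ))
      ⟨a, by rw [h2]; exact ha⟩
    have h4 : ∀ w : H θ, φ.Realize (@default _ Unique.instInhabited)
        (Fin.snoc (fun i : Fin n => (List.ofFn fun i => (x i : H θ)).getD i default) w : _ → H θ) →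
        φ.Realize (@default _ Unique.instInhabited) (Fin.snoc (Subtype.val ∘ x) w : _ → H θ) := by
      intro w hw
      rw [h2] at hw
      exact hw
    exact h4 _ h3
  · intro i l hl hF
    have hmap : (l.attach.map fun x => (⟨x.1, hMH (hl x.1 x.2)⟩ : H θ)).map Subtype.val = l := by
      rw [List.map_map]
      exact List.attach_map_subtype_val l
    have h1 := hcl' (Sum.inr i) (l.attach.map fun x => (⟨x.1, hMH (hl x.1 x.2)⟩ : H θ)) (by
      intro b hb
      obtain ⟨x, -, rfl⟩ := List.mem_map.1 hb
      exact hl x.1 x.2)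
    dsimp only [Sum.elim_inr, Fl] at h1
    rw [hmap, dif_pos hF] at h1
    exact h1

/-! ### A combinatorial form of the Mapping Reflection Principle -/

/-- The mapping sends a model to a set depending only on its trace on `T`. The closed sets `Y i t`
and parameters `q i` are chosen as functions of `f`, so a model closed under these choices contains
them as soon as it contains the club. `J` stands for information about one model that the later ones
must possess. -/
theorem reflection (hMRP : MRP.{u}) {T : Type u} [Uncountable T] (G : ℕ → T → T → T)
    (J : Set T → T) (Sig : Set T → Set (Set T))
    (hopen : ∀ S, ∀ Y ∈ Sig S, ∃ x : Set T, x.Finite ∧ x ⊆ Y ∧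
      ∀ Y', x ⊆ Y' → Y' ⊆ Y → Y' ∈ Sig S)
    (hstat : ∀ f : Finset T → T, ∃ (Y : ℕ → T → Set T) (q : ℕ → T),
      (∀ i t, (Y i t).Countable ∧ (Y i t).Infinite ∧
        ∀ s : Finset T, (∀ a ∈ s, a ∈ Y i t) → f s ∈ Y i t) ∧
      ∀ S : Set T, S.Countable → S.Nonempty → (∀ n, ∀ a ∈ S, ∀ b ∈ S, G n a b ∈ S) →
        (∀ i, q i ∈ S) → ∃ i, ∃ t ∈ S, Y i t ∈ Sig S) :
    ∃ N : Ordinal.{u} → Set T,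
      (∀ ξ < ω₁, (N ξ).Countable ∧ (N ξ).Nonempty ∧
        ∀ n, ∀ a ∈ N ξ, ∀ b ∈ N ξ, G n a b ∈ N ξ) ∧
      (∀ ξ η, ξ < η → η < ω₁ → N ξ ⊆ N η ∧ J (N ξ) ∈ N η) ∧
      (∀ ξ < ω₁, Order.IsSuccLimit ξ → ∀ t ∈ N ξ, ∃ η < ξ, t ∈ N η) ∧
      ∀ ξ < ω₁, Order.IsSuccLimit ξ → ∃ ν < ξ, ∀ η, ν < η → η < ξ → N η ∈ Sig (N ξ) := by
  classical
  have hTne : Nonempty T := inferInstance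
  obtain ⟨code, hcode⟩ : ∃ code : T → ZFSet.{u}, Function.Injective code :=
    ⟨fun t => (typein (α := T) WellOrderingRel t).toZFSet,
      Ordinal.toZFSet_injective.comp (typein_injective _)⟩
  let dec : ZFSet.{u} → T := Function.invFun code
  have hdec : ∀ t, dec (code t) = t := Function.leftInverse_invFun hcode
  let X : ZFSet.{u} := ZFSet.range code
  have hX : ∀ x, x ∈ X ↔ ∃ t, code t = x := fun x => ZFSet.mem_range
  let tr : ZFSet.{u} → Set T := fun M => {t | code t ∈ M}
  let enc : Set T → ZFSet.{u} := fun S => ZFSet.range fun t : S => code t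
  have hmem_enc : ∀ S x, x ∈ enc S ↔ ∃ t ∈ S, code t = x := fun S x => by
    simp [enc, ZFSet.mem_range]
  have hcoe_enc : ∀ S, (enc S : Set ZFSet.{u}) = code '' S := fun S => by
    ext x
    exact hmem_enc S x
  have htr_enc : ∀ S, tr (enc S) = S := fun S => by
    ext t
    refine (hmem_enc S _).trans ⟨?_, fun h => ⟨t, h, rfl⟩⟩
    rintro ⟨s, hs, h⟩
    rwa [← hcode h]
  have henc_mem : ∀ S : Set T, S.Countable → S.Infinite →
      enc S ∈ subsetsOmega (X : Set ZFSet.{u}) := fun S hc hi => by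
    refine ⟨fun x hx => ?_, card_eq_aleph0_iff.2 ?_⟩
    · obtain ⟨t, -, rfl⟩ := (hmem_enc S x).1 hx
      exact (hX _).2 ⟨t, rfl⟩
    · rw [hcoe_enc]
      exact ⟨hc.image _, hi.image hcode.injOn⟩
  have htr_count : ∀ M : ZFSet.{u}, (M : Set ZFSet.{u}).Countable → (tr M).Countable :=
    fun M hM => hM.preimage hcode
  -- Clubs in [X]^ω are transported to `T` along the coding; a set that is not club receives a junk
  -- function.
  have hclub : ∀ E : ZFSet.{u}, ∃ f : Finset T → T, IsClub (X : Set ZFSet.{u}) E →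
      ∀ S : Set T, S.Countable → S.Infinite →
        (∀ s : Finset T, (∀ a ∈ s, a ∈ S) → f s ∈ S) → enc S ∈ E := by
    intro E
    by_cases hE : IsClub (X : Set ZFSet.{u}) E
    · obtain ⟨f, hf⟩ := hE
      refine ⟨fun s => dec (f (s.image fun t => ⟨code t, (hX _).2 ⟨t, rfl⟩⟩)),
        fun _ S hc hi hS => ?_⟩
      change enc S ∈ (E : Set ZFSet.{u})
      rw [hf]
      refine ⟨henc_mem S hc hi, fun s hs => ?_⟩
      have h1 := hS (s.image fun x : (X : Set ZFSet.{u}) => dec x) (by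
        intro a ha
        obtain ⟨x, hx, rfl⟩ := Finset.mem_image.1 ha
        obtain ⟨t, ht, h⟩ := (hmem_enc S _).1 (hs x hx)
        rw [← h, hdec]
        exact ht)
      have hcd : ∀ x : (X : Set ZFSet.{u}), code (dec x) = x := by
        rintro ⟨x, hx⟩
        obtain ⟨t, rfl⟩ := (hX x).1 hx
        rw [hdec]
      have h2 : ((s.image fun x : (X : Set ZFSet.{u}) => dec x).image fun t =>
          (⟨code t, (hX _).2 ⟨t, rfl⟩⟩ : (X : Set ZFSet.{u}))) = s := by
        rw [Finset.image_image]
        conv_rhs => rw [← Finset.image_id (s := s)]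
        refine Finset.image_congr fun x _ => Subtype.ext (hcd x)
      beta_reduce at h1
      rw [h2] at h1
      exact (hmem_enc S _).2 ⟨_, h1, hcd _⟩
    · exact ⟨fun _ => Classical.arbitrary T, fun h => absurd h hE⟩
  choose fE hfE using hclub
  choose Yf q hYf hq using hstat
  have henum : ∀ M : ZFSet.{u}, ∃ e : ℕ → ZFSet.{u}, (M : Set ZFSet.{u}).Countable →
      ∀ x ∈ M, ∃ n, e n = x := by
    intro M
    by_cases hM : (M : Set ZFSet.{u}).Countable ∧ (M : Set ZFSet.{u}).Nonempty
    · obtain ⟨e, he⟩ := hM.1.exists_eq_range hM.2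
      refine ⟨e, fun _ x hx => ?_⟩
      have : x ∈ Set.range e := he ▸ hx
      exact this
    · exact ⟨fun _ => ∅, fun h x hx => absurd ⟨h, x, hx⟩ hM⟩
  choose enum henum using henum
  -- A successor, hence regular, and large enough for `X` and [X]^ω to lie in H(θ).
  let θ : Cardinal.{u} := Order.succ (max ℵ₀ (max (trcl X).card (trcl (powOmega X)).card))
  have hθ : θ.IsRegular := isRegular_succ (le_max_left _ _)
  have hXH : (trcl X).card < θ := Order.lt_succ_of_le ((le_max_left _ _).trans (le_max_right _ _))
  have hPH : (trcl (powOmega X)).card < θ :=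
    Order.lt_succ_of_le ((le_max_right _ _).trans (le_max_right _ _))
  have hcodeX : ∀ t, code t ∈ X := fun t => (hX _).2 ⟨t, rfl⟩
  have hcodeH : ∀ t, code t ∈ H θ := fun t => H_transitive (θ := θ) hXH (hcodeX t)
  have hinf : Infinite (H θ) := Infinite.of_injective
    (fun t => (⟨code t, hcodeH t⟩ : H θ)) fun s t h => hcode (Subtype.ext_iff.1 h)
  -- Everything a model must be closed under. Tag 5 enumerates countable elements, making them
  -- subsets; tag 6 makes the trace nonempty.
  let F : Fin 7 × ℕ → List ZFSet.{u} → ZFSet.{u}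
    | (0, _), _ => X
    | (1, i), [x, y] => code (G i (dec x) (dec y))
    | (2, i), [E, x] => enc (Yf (fE E) i (dec x))
    | (3, i), [E] => code (q (fE E) i)
    | (4, _), [M] => code (J (tr M))
    | (5, i), [M] => enum M i
    | (6, _), _ => code (Classical.arbitrary T)
    | _, _ => ∅
  obtain ⟨D, hD, hDF⟩ := exists_isClub_elementary θ F
  have hDX : ∀ M ∈ D, X ∈ M := fun M hM => (hDF M hM).2.2 (0, 0) [] (by simp) hXH
  have hDH : ∀ M ∈ D, ∀ x ∈ M, x ∈ H θ := fun M hM => (hDF M hM).1.1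
  have hDG : ∀ M ∈ D, ∀ n, ∀ a ∈ tr M, ∀ b ∈ tr M, G n a b ∈ tr M := fun M hM n a ha b hb => by
    have := (hDF M hM).2.2 (1, n) [code a, code b] (by
      rintro x hx
      rcases List.mem_pair.1 hx with rfl | rfl
      exacts [ha, hb]) (hcodeH _)
    change code (G n a b) ∈ M
    simpa [F, hdec] using this
  have hDne : ∀ M ∈ D, (tr M).Nonempty := fun M hM =>
    ⟨_, (hDF M hM).2.2 (6, 0) [] (by simp) (hcodeH _)⟩
  have hDY : ∀ M ∈ D, ∀ E ∈ M, ∀ i, ∀ t ∈ tr M, enc (Yf (fE E) i t) ∈ M :=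
    fun M hM E hE i t ht => by
    have := (hDF M hM).2.2 (2, i) [E, code t] (by
      rintro x hx
      rcases List.mem_pair.1 hx with rfl | rfl
      exacts [hE, ht]) (by
        refine H_transitive (θ := θ) hPH ?_
        change _ ∈ (powOmega X : Set ZFSet.{u})
        rw [coe_powOmega]
        exact henc_mem _ (hYf _ _ _).1 (hYf _ _ _).2.1)
    simpa [F, hdec] using this
  have hDq : ∀ M ∈ D, ∀ E ∈ M, ∀ i, q (fE E) i ∈ tr M := fun M hM E hE i =>
    (hDF M hM).2.2 (3, i) [E] (by simpa using hE) (hcodeH _)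
  have hDJ : ∀ M ∈ D, ∀ M' ∈ M, J (tr M') ∈ tr M := fun M hM M' hM' =>
    (hDF M hM).2.2 (4, 0) [M'] (by simpa using hM') (hcodeH _)
  have hDsub : ∀ M ∈ D, ∀ M' ∈ M, (M' : Set ZFSet.{u}).Countable → ∀ x ∈ M', x ∈ M :=
    fun M hM M' hM' hc x hx => by
    obtain ⟨n, rfl⟩ := henum M' hc x hx
    exact (hDF M hM).2.2 (5, n) [M'] (by simpa using hM')
      (H_transitive (hDH M hM M' hM') hx)
  have hmap : IsOpenStationaryMapping X θ D
      fun M => {Y | Y ∈ subsetsOmega (X : Set ZFSet.{u}) ∧ tr Y ∈ Sig (tr M)} :=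
    { uncountable := by
        rw [← Cardinal.lift_lt.{u, u + 1}, ← ZFSet.cardinalMk_coe_sort, Cardinal.lift_aleph0]
        have h1 : (X : Set ZFSet.{u}) = Set.range code := ZFSet.coe_range code
        change ℵ₀ < #((X : Set ZFSet.{u}))
        rw [← not_le, Cardinal.le_aleph0_iff_set_countable, h1]
        exact fun h => Set.not_countable_univ (by simpa using h.preimage hcode)
      regular := hθ
      powOmega_mem := hPH
      club := hD
      elementary := fun M hM => (hDF M hM).1
      mem := hDX
      subset := fun M _ Y hY => hY.1
      isOpen := by
        intro M hM
        -- The union of all basic sets contained in the value; around `Y` the set [x, Y] works.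
        refine ⟨{b | ∃ x N : ZFSet.{u}, N ∈ subsetsOmega (X : Set ZFSet.{u}) ∧ x ⊆ N ∧
          (x : Set ZFSet.{u}).Finite ∧ b = ellentuckBasic X x N ∧
          b ⊆ {Y | Y ∈ subsetsOmega (X : Set ZFSet.{u}) ∧ tr Y ∈ Sig (tr M)}}, ?_, ?_⟩
        · rintro b ⟨x, N, h1, h2, h3, h4, -⟩
          exact ⟨x, N, h1, h2, h3, h4⟩
        · refine Set.Subset.antisymm ?_ ?_
          · rintro Y ⟨hYX, hY⟩
            obtain ⟨x, hxf, hxY, hx⟩ := hopen _ _ hY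
            refine ⟨ellentuckBasic X (enc x) Y, ⟨enc x, Y, hYX, ?_, ?_, rfl, ?_⟩, hYX, ?_, ?_⟩
            · intro z hz
              obtain ⟨t, ht, rfl⟩ := (hmem_enc _ _).1 hz
              exact hxY ht
            · rw [hcoe_enc]
              exact hxf.image _
            · rintro Z ⟨hZX, hxZ, hZY⟩
              exact ⟨hZX, hx _ (fun t ht => hxZ ((hmem_enc _ _).2 ⟨t, ht, rfl⟩))
                fun t ht => hZY ht⟩
            · intro z hz
              obtain ⟨t, ht, rfl⟩ := (hmem_enc _ _).1 hz
              exact hxY ht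
            · exact fun z hz => hz
          · rintro Y ⟨b, ⟨x, N, -, -, -, -, hb⟩, hYb⟩
            exact hb hYb
      stationary := by
        intro M hM E hE hEc
        obtain ⟨i, t, ht, hi⟩ := hq (fE E) (tr M) (htr_count M (hDF M hM).2.1) (hDne M hM)
          (hDG M hM) (hDq M hM E hE)
        obtain ⟨h1, h2, h3⟩ := hYf (fE E) i t
        refine ⟨enc (Yf (fE E) i t), ⟨henc_mem _ h1 h2, ?_⟩, hfE E hEc _ h1 h2 h3,
          hDY M hM E hE i t ht⟩
        rw [htr_enc]
        exact hi }
  obtain ⟨N, ⟨hN1, hN2⟩, hND, hN⟩ := hMRP X θ D _ hmap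
  refine ⟨fun ξ => tr (N ξ), fun ξ hξ => ⟨htr_count _ (hDF _ (hND ξ hξ)).2.1, hDne _ (hND ξ hξ),
    hDG _ (hND ξ hξ)⟩, fun ξ η h hη => ⟨?_, ?_⟩, fun ξ hξ hl t ht => (hN2 ξ hξ hl _).1 ht,
    fun ξ hξ hl => ?_⟩
  · exact fun t ht => hDsub _ (hND η hη) _ (hN1 ξ η h hη) (hDF _ (hND ξ (h.trans hη))).2.1 _ ht
  · exact hDJ _ (hND η hη) _ (hN1 ξ η h hη)
  · obtain ⟨ν, hν, h⟩ := hN ξ hξ hl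
    refine ⟨ν, hν, fun η h1 h2 => ?_⟩
    have h3 := (h η h1 h2).2
    have h4 : tr (N η ∩ X) = tr (N η) := by
      ext t
      change code t ∈ N η ∩ X ↔ code t ∈ N η
      rw [ZFSet.mem_inter]
      exact and_iff_left (hcodeX t)
    rwa [h4] at h3

/-! ### Countable ordinals -/

theorem countable_Iio_of_lt_omega_one {a : Ordinal.{u}} (ha : a < ω₁) : (Set.Iio a).Countable := by
  rw [← Cardinal.le_aleph0_iff_set_countable, Cardinal.mk_Iio_ordinal, Cardinal.lift_le_aleph0]
  rw [← Cardinal.ord_aleph, Cardinal.lt_ord, ← Cardinal.succ_aleph0] at ha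
  exact Order.lt_succ_iff.1 ha

theorem isSuccLimit_omega_one : Order.IsSuccLimit (ω₁ : Ordinal.{u}) := by
  rw [← Cardinal.ord_aleph]
  exact Cardinal.isSuccLimit_ord (Cardinal.aleph0_le_aleph 1)

theorem exists_lt_omega_one_of_countable {s : Set Ordinal.{u}} (hs : s.Countable)
    (h : ∀ a ∈ s, a < ω₁) : ∃ b < ω₁, ∀ a ∈ s, a < b := by
  have := hs.to_subtype
  have : Small.{u} s := small_subset (s := Set.Iio ω₁) h
  refine ⟨Order.succ (⨆ a : s, (a : Ordinal.{u})), isSuccLimit_omega_one.succ_lt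
    (Ordinal.iSup_lt_omega_one fun a => h a a.2), fun a ha => Order.lt_succ_of_le ?_⟩
  exact le_ciSup Ordinal.bddAbove_of_small (⟨a, ha⟩ : s)

/-- Iterate, from 0, a step that exceeds all values of `F` up to the current point; the supremum of
the ω steps is closed. -/
theorem exists_closed_lt_omega_one (F : Ordinal.{u} → Ordinal.{u}) (hF : ∀ a < ω₁, F a < ω₁) :
    ∃ δ < ω₁, Order.IsSuccLimit δ ∧ ∀ a < δ, F a < δ := by
  have hstep : ∀ a : Ordinal.{u}, ∃ b, a < ω₁ → b < ω₁ ∧ a < b ∧ ∀ c ≤ a, F c < b := by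
    intro a
    by_cases ha : a < ω₁
    · have ha' := isSuccLimit_omega_one.succ_lt ha
      obtain ⟨b, hb, hb'⟩ := exists_lt_omega_one_of_countable
        (s := insert a (F '' Set.Iio (Order.succ a)))
        (((countable_Iio_of_lt_omega_one ha').image F).insert a) (by
          rintro _ (rfl | ⟨c, hc, rfl⟩)
          · exact ha
          · exact hF c (lt_trans hc ha'))
      exact ⟨b, fun _ => ⟨hb, hb' _ (Set.mem_insert _ _), fun c hc =>
        hb' _ (Or.inr ⟨c, Order.lt_succ_of_le hc, rfl⟩)⟩⟩
    · exact ⟨0, fun h => absurd h ha⟩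
  choose g hg using hstep
  let x : ℕ → Ordinal.{u} := fun n => g^[n] 0
  have hx : ∀ n, x (n + 1) = g (x n) := fun n => Function.iterate_succ_apply' g n 0
  have hx1 : ∀ n, x n < ω₁ := by
    intro n
    induction n with
    | zero => exact isSuccLimit_omega_one.bot_lt
    | succ n ih => rw [hx]; exact (hg _ ih).1
  have hlt : ∀ n, x n < x (n + 1) := fun n => by rw [hx]; exact (hg _ (hx1 n)).2.1
  have hle : ∀ n, x n < ⨆ n, x n := fun n =>
    (hlt n).trans_le (le_ciSup Ordinal.bddAbove_of_small (n + 1))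
  have hF' : ∀ a < ⨆ n, x n, ∃ n, a < x n := fun a ha => Ordinal.lt_iSup_iff.1 ha
  refine ⟨⨆ n, x n, Ordinal.iSup_lt_omega_one hx1, ?_, fun a ha => ?_⟩
  · rw [Order.isSuccLimit_iff, isMin_iff_eq_bot, Order.isSuccPrelimit_iff_succ_lt]
    refine ⟨fun h => not_lt_bot (h ▸ hle 0), fun a ha => ?_⟩
    obtain ⟨n, hn⟩ := hF' a ha
    exact (Order.succ_le_of_lt hn).trans_lt (hle n)
  · obtain ⟨n, hn⟩ := hF' a ha
    refine lt_of_lt_of_le ?_ (hle (n + 1)).le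
    rw [hx]
    exact (hg _ (hx1 n)).2.2 a hn.le

/-- Stationary sets of countable ordinals. -/
def Stationary (B : Set Ordinal.{u}) : Prop :=
  ∀ F : Ordinal.{u} → Ordinal.{u}, (∀ a < ω₁, F a < ω₁) →
    ∃ δ ∈ B, δ < ω₁ ∧ Order.IsSuccLimit δ ∧ ∀ a < δ, F a < δ

/-- Countably many functions witnessing nonstationarity are dominated by a single one. -/
theorem Stationary.exists_of_subset_iUnion {ι : Type} [Countable ι] {B : Set Ordinal.{u}}
    (hB : Stationary B) (C : ι → Set Ordinal.{u}) (h : B ⊆ ⋃ i, C i) :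
    ∃ i, Stationary (C i) := by
  by_contra! hC
  simp only [Stationary] at hC
  push Not at hC
  choose F hF hF' using hC
  have hsup : ∀ a : Ordinal.{u}, ∃ b, a < ω₁ → b < ω₁ ∧ ∀ i, F i a < b := by
    intro a
    by_cases ha : a < ω₁
    · obtain ⟨b, hb, hb'⟩ := exists_lt_omega_one_of_countable (Set.countable_range fun i => F i a)
        (by rintro _ ⟨i, rfl⟩; exact hF i a ha)
      exact ⟨b, fun _ => ⟨hb, fun i => hb' _ ⟨i, rfl⟩⟩⟩
    · exact ⟨0, fun h => absurd h ha⟩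
  choose G hG using hsup
  obtain ⟨δ, hδB, hδ, hl, hcl⟩ := hB G fun a ha => (hG a ha).1
  obtain ⟨i, hi⟩ := Set.mem_iUnion.1 (h hδB)
  obtain ⟨a, ha, ha'⟩ := hF' i δ hi hδ hl
  exact absurd (((hG a (ha.trans hδ)).2 i).trans (hcl a ha)) (not_lt.2 ha')

/-- There is a partition of the countable ordinals into countably many stationary sets. -/
theorem exists_stationary_fibers :
    ∃ h : Ordinal.{u} → ℕ, ∀ n, Stationary {a | h a = n} := by
  classical
  have he : ∀ a : Ordinal.{u}, ∃ e : Ordinal.{u} → ℕ, a < ω₁ → Set.InjOn e (Set.Iio a) := by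
    intro a
    by_cases ha : a < ω₁
    · obtain ⟨e, he⟩ := Set.countable_iff_exists_injOn.1 (countable_Iio_of_lt_omega_one ha)
      exact ⟨e, fun _ => he⟩
    · exact ⟨fun _ => 0, fun h => absurd h ha⟩
  choose e he using he
  -- Ulam's matrix: for each x some value e_a(x) = n is taken for stationarily many a.
  have h1 : ∀ x : Ordinal.{u}, ∃ n, x < ω₁ → Stationary {a | a < ω₁ ∧ x < a ∧ e a x = n} := by
    intro x
    by_cases hx : x < ω₁
    · have hst : Stationary {a | a < ω₁ ∧ x < a} := by
        intro F hF
        obtain ⟨δ, h1, h2, h3⟩ := exists_closed_lt_omega_one (fun a => max x (F a))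
          fun a ha => max_lt hx (hF a ha)
        exact ⟨δ, ⟨h1, (le_max_left _ _).trans_lt (h3 0 h2.bot_lt)⟩, h1, h2, fun a ha =>
          (le_max_right _ _).trans_lt (h3 a ha)⟩
      obtain ⟨n, hn⟩ := hst.exists_of_subset_iUnion
        (fun n => {a | a < ω₁ ∧ x < a ∧ e a x = n})
        fun a ha => Set.mem_iUnion.2 ⟨e a x, ha.1, ha.2, rfl⟩
      exact ⟨n, fun _ => hn⟩
    · exact ⟨0, fun h => absurd h hx⟩
  choose m hm using h1
  -- Infinitely many x share one n; injectivity of each e_a makes their stationary sets disjoint.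
  obtain ⟨n, hn⟩ : ∃ n, (Set.Iio ω₁ ∩ m ⁻¹' {n}).Infinite := by
    by_contra! hfin
    have hc : (⋃ n, Set.Iio (ω₁ : Ordinal.{u}) ∩ m ⁻¹' {n}).Countable :=
      Set.countable_iUnion fun n => (hfin n).countable
    obtain ⟨b, hb, hb'⟩ := exists_lt_omega_one_of_countable hc fun a ha => by
      obtain ⟨n, h, -⟩ := Set.mem_iUnion.1 ha
      exact h
    exact lt_irrefl b (hb' b (Set.mem_iUnion.2 ⟨m b, hb, rfl⟩))
  let x := hn.natEmbedding
  have hx : ∀ i, (x i : Ordinal.{u}) < ω₁ ∧ m (x i) = n := fun i => (x i).2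
  have huniq : ∀ a i j, a < ω₁ → (x i : Ordinal.{u}) < a → (x j : Ordinal.{u}) < a →
      e a (x i) = n → e a (x j) = n → i = j := fun a i j ha hi hj h h' =>
    x.injective (Subtype.ext (he a ha hi hj (h.trans h'.symm)))
  refine ⟨fun a => if h : ∃ i, (x i : Ordinal.{u}) < a ∧ e a (x i) = n then h.choose else 0,
    fun i F hF => ?_⟩
  have hs := hm (x i) (hx i).1
  rw [(hx i).2] at hs
  obtain ⟨δ, ⟨h1, h2, h3⟩, h⟩ := hs F hF
  refine ⟨δ, ?_, h⟩
  have hex : ∃ i, (x i : Ordinal.{u}) < δ ∧ e δ (x i) = n := ⟨i, h2, h3⟩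
  change (if h : _ then _ else _) = i
  rw [dif_pos hex]
  exact huniq δ _ _ h1 hex.choose_spec.1 h2 hex.choose_spec.2 h3

/-! ### Well-orders whose order type is a successor cardinal -/

theorem mk_iUnion_le_of_le {α ι : Type u} {κ : Cardinal.{u}} (hκ : ℵ₀ ≤ κ) (hι : #ι ≤ κ)
    (f : ι → Set α) (hf : ∀ i, #(f i) ≤ κ) : #(⋃ i, f i) ≤ κ :=
  (Cardinal.mk_iUnion_le f).trans <| (mul_le_mul' hι (ciSup_le' hf)).trans
    (Cardinal.mul_eq_self hκ).le

/-- The well-order `T` has the order type of the successor of the infinite cardinal `κ`. -/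
structure IsSuccType (T : Type u) [LinearOrder T] [WellFoundedLT T] (κ : Cardinal.{u}) : Prop where
  aleph0_le : ℵ₀ ≤ κ
  mk_eq : #T = Order.succ κ
  mk_Iio_le : ∀ t : T, #(Set.Iio t) ≤ κ

theorem isSuccType_toType {κ : Cardinal.{u}} (hκ : ℵ₀ ≤ κ) :
    IsSuccType (Order.succ κ).ord.ToType κ where
  aleph0_le := hκ
  mk_eq := Cardinal.mk_ord_toType _
  mk_Iio_le t := by
    have := Cardinal.mk_Iio_lt t (by simp)
    rw [Cardinal.mk_ord_toType] at this
    exact Order.lt_succ_iff.1 this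

namespace IsSuccType

variable {T : Type u} [LinearOrder T] [WellFoundedLT T] {κ : Cardinal.{u}}

theorem exists_forall_lt (hT : IsSuccType T κ) {s : Set T} (hs : #s ≤ κ) : ∃ t, ∀ x ∈ s, x < t := by
  by_contra! h
  have h1 : (⋃ x : s, Set.Iic (x : T)) = Set.univ := Set.eq_univ_of_forall fun t => by
    obtain ⟨x, hx, hxt⟩ := h t
    exact Set.mem_iUnion.2 ⟨⟨x, hx⟩, hxt⟩
  have h2 : #(⋃ x : s, Set.Iic (x : T)) ≤ κ := mk_iUnion_le_of_le hT.aleph0_le hs _ fun x => by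
    rw [← Set.Iio_insert]
    exact (Cardinal.mk_insert_le).trans
      (Cardinal.add_le_of_le hT.aleph0_le (hT.mk_Iio_le x)
        (Cardinal.one_le_aleph0.trans hT.aleph0_le))
  rw [h1, Cardinal.mk_univ, hT.mk_eq] at h2
  exact (Order.lt_succ κ).not_ge h2

theorem mk_le_of_countable (hT : IsSuccType T κ) {s : Set T} (hs : s.Countable) : #s ≤ κ :=
  (Cardinal.le_aleph0_iff_set_countable.2 hs).trans hT.aleph0_le

theorem exists_gt (hT : IsSuccType T κ) (t : T) : ∃ t', t < t' := by
  obtain ⟨t', h⟩ := hT.exists_forall_lt (hT.mk_le_of_countable (Set.countable_singleton t))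
  exact ⟨t', h t rfl⟩

theorem uncountable (hT : IsSuccType T κ) : Uncountable T := by
  rw [← Cardinal.aleph0_lt_mk_iff, hT.mk_eq]
  exact hT.aleph0_le.trans_lt (Order.lt_succ κ)

theorem exists_isLUB (hT : IsSuccType T κ) {s : Set T} (hs : s.Countable) : ∃ a, IsLUB s a := by
  obtain ⟨t, ht⟩ := hT.exists_forall_lt (hT.mk_le_of_countable hs)
  have hne : (upperBounds s).Nonempty := ⟨t, fun x hx => (ht x hx).le⟩
  refine ⟨wellFounded_lt.min (upperBounds s) hne, wellFounded_lt.min_mem _ hne, fun b hb => ?_⟩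
  exact not_lt.1 (wellFounded_lt.not_lt_min _ hb)

/-- A partition of `T` into at most `κ` pieces has an unbounded piece. -/
theorem exists_unbounded_fiber (hT : IsSuccType T κ) {I : Type u} (hI : #I ≤ κ) (g : T → I) :
    ∃ i, ∀ b, ∃ t, b ≤ t ∧ g t = i := by
  by_contra! h
  choose b hb using h
  obtain ⟨t, ht⟩ := hT.exists_forall_lt (Cardinal.mk_range_le.trans hI : #(Set.range b) ≤ κ)
  exact hb (g t) t (ht _ ⟨_, rfl⟩).le rfl

/-- An unbounded range has κ⁺ elements, since sets of size at most κ are bounded. -/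
theorem exists_injective_comp (hT : IsSuccType T κ) {α : T → T} (hα : ∀ b, ∃ t, b ≤ α t) :
    ∃ g : T → T, Function.Injective (α ∘ g) := by
  have h1 : #T ≤ #(Set.range α) := by
    rw [hT.mk_eq, Order.succ_le_iff]
    by_contra! h
    obtain ⟨t, ht⟩ := hT.exists_forall_lt h
    obtain ⟨s, hs⟩ := hα t
    exact (ht _ ⟨s, rfl⟩).not_ge hs
  obtain ⟨j⟩ := h1
  choose g hg using fun t => (j t).2
  refine ⟨g, fun s t h => j.injective (Subtype.ext ?_)⟩
  rw [← hg s, ← hg t]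
  exact h

end IsSuccType

/-! ### Ladders and countable closed sets -/

/-- Every countable set without a last element has a cofinal increasing sequence. -/
theorem exists_ladder {T : Type u} [LinearOrder T] {S : Set T} (hc : S.Countable)
    (hne : S.Nonempty) (hmax : ∀ s ∈ S, ∃ t ∈ S, s < t) :
    ∃ c : ℕ → T, Monotone c ∧ (∀ n, c n ∈ S) ∧ ∀ s ∈ S, ∃ n, s < c n := by
  obtain ⟨e, he⟩ := hc.exists_eq_range hne
  have hmem : ∀ n, e n ∈ S := fun n => he ▸ Set.mem_range_self n
  refine ⟨partialSups e, (partialSups e).monotone, fun n => ?_, fun s hs => ?_⟩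
  · induction n with
    | zero => simpa using hmem 0
    | succ n ih =>
      rw [partialSups_add_one]
      rcases max_choice (partialSups e n) (e (n + 1)) with h | h <;> rw [h]
      exacts [ih, hmem _]
  · obtain ⟨t, ht, hst⟩ := hmax s hs
    rw [he] at ht
    obtain ⟨n, rfl⟩ := ht
    exact ⟨n, hst.trans_le (le_partialSups e n)⟩

theorem exists_ladder_fun (T : Type u) [LinearOrder T] [Nonempty T] :
    ∃ c : Set T → ℕ → T, ∀ S : Set T, S.Countable → S.Nonempty → (∀ s ∈ S, ∃ t ∈ S, s < t) →
      Monotone (c S) ∧ (∀ n, c S n ∈ S) ∧ ∀ s ∈ S, ∃ n, s < c S n := by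
  have : ∀ S : Set T, ∃ c : ℕ → T, S.Countable → S.Nonempty → (∀ s ∈ S, ∃ t ∈ S, s < t) →
      Monotone c ∧ (∀ n, c n ∈ S) ∧ ∀ s ∈ S, ∃ n, s < c n := by
    intro S
    by_cases h : S.Countable ∧ S.Nonempty ∧ ∀ s ∈ S, ∃ t ∈ S, s < t
    · obtain ⟨c, hc⟩ := exists_ladder h.1 h.2.1 h.2.2
      exact ⟨c, fun _ _ _ => hc⟩
    · exact ⟨fun _ => Classical.arbitrary T, fun h1 h2 h3 => absurd ⟨h1, h2, h3⟩ h⟩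
  choose c hc using this
  exact ⟨c, hc⟩

theorem exists_countable_finset_closed {T : Type u} [Infinite T] (f : Finset T → T) (Z : Set T)
    (hZ : Z.Countable) : ∃ Y : Set T, Z ⊆ Y ∧ Y.Countable ∧ Y.Infinite ∧
      ∀ s : Finset T, (∀ a ∈ s, a ∈ Y) → f s ∈ Y := by
  classical
  obtain ⟨Y, h1, h2, h3⟩ := exists_countable_closed (fun l => f l.toFinset)
    (Z ∪ Set.range (Infinite.natEmbedding T)) (hZ.union (Set.countable_range _))
  refine ⟨Y, Set.subset_union_left.trans h1, h2,
    (Set.infinite_range_of_injective (Infinite.natEmbedding T).injective).mono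
      (Set.subset_union_right.trans h1), fun s hs => ?_⟩
  have := h3 s.toList (by simpa using hs)
  simpa using this

/-! ### Adherent points and covering matrices -/

/-- The points of `D` together with its limits. -/
def adherent {T : Type u} [LinearOrder T] (D : Set T) : Set T :=
  {α | ∀ γ < α, ∃ d ∈ D, γ < d ∧ d ≤ α}

section adherent

variable {T : Type u} [LinearOrder T]

theorem subset_adherent (D : Set T) : D ⊆ adherent D := fun α hα _ hγ => ⟨α, hα, hγ, le_rfl⟩

theorem adherent_mono {D D' : Set T} (h : D ⊆ D') : adherent D ⊆ adherent D' := fun α hα γ hγ => by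
  obtain ⟨d, hd, h'⟩ := hα γ hγ
  exact ⟨d, h hd, h'⟩

/-- This left-openness is why limits are added: it makes the condition that a supremum avoid a
matrix entry Ellentuck open. -/
theorem exists_interval_of_notMem_adherent {D : Set T} {α : T} (h : α ∉ adherent D) :
    ∃ γ < α, ∀ α', γ < α' → α' ≤ α → α' ∉ adherent D := by
  simp only [adherent, Set.mem_ofPred_eq] at h
  push Not at h
  obtain ⟨γ, hγ, h⟩ := h
  refine ⟨γ, hγ, fun α' h1 h2 h3 => ?_⟩
  obtain ⟨d, hd, h4, h5⟩ := h3 γ h1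
  exact (h d hd h4).not_ge (h5.trans h2)

/-- Send a new point to the least element of `D` above it, or to `none`. Two new points are
separated by an element of `D`, so this is injective and at most #D + 1 points are added. -/
theorem mk_adherent_lt [WellFoundedLT T] {κ : Cardinal.{u}} (hκ : ℵ₀ ≤ κ) {D : Set T}
    (hD : #D < κ) : #(adherent D) < κ := by
  have hnext : ∀ α : T, ∃ o : Option D, (∀ d : D, o = some d → α < d) ∧
      ∀ d ∈ D, α < d → ∃ d₀ : D, o = some d₀ ∧ (d₀ : T) ≤ d := by
    intro α
    by_cases h : {d : T | d ∈ D ∧ α < d}.Nonempty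
    · have hm := wellFounded_lt.min_mem _ h
      refine ⟨some ⟨_, hm.1⟩, ?_, fun d hd h1 =>
        ⟨_, rfl, not_lt.1 (wellFounded_lt.not_lt_min {d : T | d ∈ D ∧ α < d}
          (show d ∈ {d : T | d ∈ D ∧ α < d} from ⟨hd, h1⟩))⟩⟩
      rintro _ ⟨⟩
      exact hm.2
    · exact ⟨none, by simp, fun d hd h1 =>
        absurd (show {d : T | d ∈ D ∧ α < d}.Nonempty from ⟨d, hd, h1⟩) h⟩
  choose next hlt hle using hnext
  have key : ∀ α, ∀ α' ∈ adherent D \ D, α < α' → next α ≠ next α' := by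
    intro α α' hα' h heq
    obtain ⟨d, hd, h1, h2⟩ := hα'.1 α h
    obtain ⟨d₀, h3, h4⟩ := hle α d hd h1
    have h5 : d < α' := lt_of_le_of_ne h2 fun h => hα'.2 (h ▸ hd)
    exact lt_irrefl α' ((hlt α' d₀ (heq ▸ h3)).trans_le (h4.trans h5.le))
  have hinj : Function.Injective fun α : ↥(adherent D \ D) => next α := by
    intro α α' h
    rcases lt_trichotomy (α : T) α' with h1 | h1 | h1
    · exact absurd h (key α α' α'.2 h1)
    · exact Subtype.ext h1
    · exact absurd h.symm (key α' α α.2 h1)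
  have h1 : #(adherent D \ D : Set T) ≤ #D + 1 := by
    simpa using Cardinal.mk_le_of_injective hinj
  have h2 : #(adherent D) ≤ (#D + 1) + #D := by
    rw [← Set.sdiff_union_of_subset (subset_adherent D)]
    exact (Cardinal.mk_union_le _ _).trans (add_le_add_left h1 _)
  exact h2.trans_lt (Cardinal.add_lt_of_lt hκ
    (Cardinal.add_lt_of_lt hκ hD (Cardinal.one_lt_aleph0.trans_le hκ)) hD)

end adherent

theorem exists_iUnion_lt_of_cof_le {κ : Cardinal.{u}} (hκ : ℵ₀ ≤ κ) (hcof : κ.ord.cof ≤ ℵ₀) :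
    ∃ K : ℕ → Set κ.ord.ToType, Monotone K ∧ (∀ n, #(K n) < κ) ∧ ∀ k, ∃ n, k ∈ K n := by
  rw [← Ordinal.cof_toType] at hcof
  obtain ⟨s, hs, hsc⟩ := Order.exists_cof_eq (α := κ.ord.ToType)
  rw [← hsc, Cardinal.le_aleph0_iff_set_countable] at hcof
  have hne : Nonempty κ.ord.ToType := by
    rw [← Cardinal.mk_ne_zero_iff, Cardinal.mk_ord_toType]
    exact (Cardinal.aleph0_pos.trans_le hκ).ne'
  have hsne : s.Nonempty := by
    obtain ⟨y, hy, -⟩ := hs (Classical.arbitrary _)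
    exact ⟨y, hy⟩
  obtain ⟨e, he⟩ := hcof.exists_eq_range hsne
  refine ⟨fun n => Set.Iic (partialSups e n),
    fun m n h => Set.Iic_subset_Iic.2 ((partialSups e).monotone h), fun n => ?_, fun k => ?_⟩
  · have := Cardinal.mk_Iio_lt (partialSups e n) (by simp)
    rw [Cardinal.mk_ord_toType] at this
    beta_reduce
    rw [← Set.Iio_insert]
    exact Cardinal.mk_insert_le.trans_lt
      (Cardinal.add_lt_of_lt hκ this (Cardinal.one_lt_aleph0.trans_le hκ))
  · obtain ⟨y, hy, hky⟩ := hs k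
    rw [he] at hy
    obtain ⟨n, rfl⟩ := hy
    exact ⟨n, hky.trans (le_partialSups e n)⟩

/-- A covering matrix on the successor of a cardinal of countable cofinality. -/
theorem exists_covering_matrix {T : Type u} [LinearOrder T] [WellFoundedLT T] {κ : Cardinal.{u}}
    (hT : IsSuccType T κ) (hκ : ℵ₀ < κ) (hcof : κ.ord.cof ≤ ℵ₀) :
    ∃ D : ℕ → T → Set T, (∀ n β, #(D n β) < κ) ∧ (∀ β, Monotone fun n => D n β) ∧
      (∀ β β', β' ≤ β → ∃ n, β' ∈ D n β) ∧
      ∀ β β', β' ≤ β → ∀ n, ∃ m, D n β' ⊆ D m β := by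
  obtain ⟨K, hKmono, hKlt, hK⟩ := exists_iUnion_lt_of_cof_le hκ.le hcof
  have hφ : ∀ β : T, ∃ φ : κ.ord.ToType → T, ∀ t ≤ β, ∃ k, φ k = t := by
    intro β
    obtain ⟨β', hβ'⟩ := hT.exists_gt β
    have h1 : #(Set.Iic β) ≤ #κ.ord.ToType := by
      rw [Cardinal.mk_ord_toType]
      exact (Cardinal.mk_le_mk_of_subset fun t ht => lt_of_le_of_lt ht hβ').trans
        (hT.mk_Iio_le β')
    obtain ⟨j⟩ := h1
    have : Nonempty (Set.Iic β) := ⟨⟨β, le_rfl⟩⟩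
    exact ⟨fun k => (Function.invFun j k : Set.Iic β), fun t ht => ⟨j ⟨t, ht⟩,
      congrArg Subtype.val (Function.leftInverse_invFun j.injective ⟨t, ht⟩)⟩⟩
  choose φ hφ using hφ
  -- The points reached from `β` by finite walks with steps indexed in `K n`. Walks can be prolonged
  -- at the start: a step from `β` to `β'` puts column `β'` inside column `β`, which gives
  -- coherence.
  let D : ℕ → T → Set T := fun n β => {t | ∃ l : List κ.ord.ToType, (∀ k ∈ l, k ∈ K n) ∧
    l.foldl φ β = t}
  have hmono : ∀ β, Monotone fun n => D n β := by
    rintro β m n h t ⟨l, hl, rfl⟩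
    exact ⟨l, fun k hk => hKmono h (hl k hk), rfl⟩
  refine ⟨D, fun n β => ?_, hmono, fun β β' h => ?_, fun β β' h n => ?_⟩
  · have h1 : D n β ⊆ Set.range fun l : List (K n) => (l.map Subtype.val).foldl φ β := by
      rintro t ⟨l, hl, rfl⟩
      have : l ∈ Set.range (List.map ((↑) : K n → κ.ord.ToType)) := by
        rw [Set.range_list_map_coe]
        exact hl
      obtain ⟨l', rfl⟩ := this
      exact ⟨l', rfl⟩
    exact ((Cardinal.mk_le_mk_of_subset h1).trans Cardinal.mk_range_le).trans_lt
      ((Cardinal.mk_list_le_max _).trans_lt (max_lt hκ (hKlt n)))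
  · obtain ⟨k, hk⟩ := hφ β β' h
    obtain ⟨n, hn⟩ := hK k
    exact ⟨n, [k], by simpa using hn, hk⟩
  · obtain ⟨k, hk⟩ := hφ β β' h
    obtain ⟨m, hm⟩ := hK k
    refine ⟨max n m, ?_⟩
    rintro t ⟨l, hl, rfl⟩
    refine ⟨k :: l, fun k' hk' => ?_, by rw [List.foldl_cons, hk]⟩
    rcases List.mem_cons.1 hk' with rfl | hk'
    · exact hKmono (le_max_right n m) hm
    · exact hKmono (le_max_left n m) (hl k' hk')

/-- If `κ` has countable cofinality and `κ⁺ ^ ℵ₀ > κ⁺` then no family of points which is unbounded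
in `κ⁺` has all its countable subfamilies covered by the entries of a matrix with small entries. -/
theorem exists_uncovered {T : Type u} [LinearOrder T] [WellFoundedLT T] {κ : Cardinal.{u}}
    (hT : IsSuccType T κ) (hpow : ∀ μ < κ, μ ^ ℵ₀ ≤ κ) (hlt : Order.succ κ < Order.succ κ ^ ℵ₀)
    (D : ℕ → T → Set T) (hD : ∀ n β, #(D n β) < κ) {α : T → T} (hα : ∀ b, ∃ t, b ≤ α t) :
    ∃ b : ℕ → T, ∀ n β, ∃ i, α (b i) ∉ D n β := by
  by_contra! hcov
  obtain ⟨g, hg⟩ := hT.exists_injective_comp hα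
  refine hlt.not_ge ?_
  have h1 : #(ℕ → T) = Order.succ κ ^ ℵ₀ := by
    rw [Cardinal.mk_pi, Cardinal.prod_const]
    simp [hT.mk_eq]
  rw [← h1]
  -- If every sequence were covered, all (κ⁺)^ℵ₀ of these would lie in κ⁺ sets of size at most κ.
  have h2 : Function.Injective fun (b : ℕ → T) i => α (g (b i)) := fun b b' h =>
    funext fun i => hg (congrFun h i)
  have h3 : (Set.range fun (b : ℕ → T) i => α (g (b i))) ⊆
      ⋃ p : ULift.{u} ℕ × T, {x : ℕ → T | ∀ i, x i ∈ D p.1.down p.2} := by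
    rintro _ ⟨b, rfl⟩
    obtain ⟨n, β, h⟩ := hcov fun i => g (b i)
    exact Set.mem_iUnion.2 ⟨(⟨n⟩, β), h⟩
  have hs : ℵ₀ ≤ Order.succ κ := hT.aleph0_le.trans (Order.le_succ κ)
  refine (Cardinal.mk_range_eq _ h2).ge.trans ((Cardinal.mk_le_mk_of_subset h3).trans
    (mk_iUnion_le_of_le hs ?_ _ fun p => ?_))
  · rw [Cardinal.mk_prod, Cardinal.lift_id, Cardinal.lift_id, hT.mk_eq]
    refine (mul_le_mul_left ?_ _).trans (Cardinal.mul_eq_self hs).le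
    simpa using hs
  · have h4 : #{x : ℕ → T | ∀ i, x i ∈ D p.1.down p.2} = #(ℕ → D p.1.down p.2) :=
      Cardinal.mk_congr (Equiv.subtypePiEquivPi (p := fun _ t => t ∈ D p.1.down p.2))
    rw [h4, Cardinal.mk_pi, Cardinal.prod_const]
    simpa using (hpow _ (hD _ _)).trans (Order.le_succ κ)

theorem IsSuccType.exists_forall_omega_one_lt {T : Type u} [LinearOrder T] [WellFoundedLT T]
    {κ : Cardinal.{u}} (hT : IsSuccType T κ) (hκ : ℵ₀ < κ) (a : Ordinal.{u} → T) :
    ∃ δ, ∀ ξ < ω₁, a ξ < δ := by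
  obtain ⟨δ, hδ⟩ := hT.exists_forall_lt
    (s := Set.range fun w : (ω₁ : Ordinal.{u}).ToType => a (Ordinal.ToType.mk.symm w)) (by
      refine Cardinal.mk_range_le.trans ?_
      rw [Cardinal.mk_toType, Ordinal.card_omega, ← Cardinal.succ_aleph0]
      exact Order.succ_le_of_lt hκ)
  exact ⟨δ, fun ξ hξ => hδ _ ⟨Ordinal.ToType.mk ⟨ξ, hξ⟩, by simp⟩⟩

theorem stationary_Iio_omega_one : Stationary (Set.Iio (ω₁ : Ordinal.{u})) := fun F hF => by
  obtain ⟨δ, h1, h2⟩ := exists_closed_lt_omega_one F hF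
  exact ⟨δ, h1, h1, h2⟩

theorem Stationary.exists_gt {B : Set Ordinal.{u}} (hB : Stationary B) {a : Ordinal.{u}}
    (ha : a < ω₁) : ∃ b ∈ B, b < ω₁ ∧ a < b := by
  obtain ⟨δ, h1, h2, h3, h4⟩ := hB (fun _ => a) fun _ _ => ha
  exact ⟨δ, h1, h2, h4 0 h3.bot_lt⟩

/-- A single `γ` captures the traces on the countable set `S` of all columns of the matrix. -/
theorem exists_capturing_column {T : Type u} [LinearOrder T] [WellFoundedLT T] {κ : Cardinal.{u}}
    (hT : IsSuccType T κ) (h2 : 2 ^ ℵ₀ ≤ κ) (D : ℕ → T → Set T)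
    (hD : ∀ β β', β' ≤ β → ∀ n, ∃ m, D n β' ⊆ D m β) {S : Set T} (hS : S.Countable) :
    ∃ γ, ∀ β n, ∃ m, ∀ t ∈ S, t ∈ D n β → t ∈ D m γ := by
  have hcard : #(ℕ → Set S) ≤ κ := by
    rw [Cardinal.mk_pi, Cardinal.prod_const, Cardinal.mk_set]
    simp only [Cardinal.mk_nat, Cardinal.lift_aleph0, Cardinal.lift_id']
    rw [← Cardinal.power_mul]
    refine le_trans (Cardinal.power_le_power_left two_ne_zero ?_) h2
    exact (mul_le_mul_left (Cardinal.le_aleph0_iff_set_countable.2 hS) _).trans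
      Cardinal.aleph0_mul_aleph0.le
  -- There are at most κ sequences of traces on `S`, so one recurs unboundedly. Any `β` lies below a
  -- column with these traces, and `γ` has the same traces.
  obtain ⟨i, hi⟩ := hT.exists_unbounded_fiber hcard fun β n => {t : S | (t : T) ∈ D n β}
  have := hT.uncountable
  obtain ⟨γ, -, hγ⟩ := hi (Classical.arbitrary T)
  refine ⟨γ, fun β n => ?_⟩
  obtain ⟨β', hβ', hi'⟩ := hi β
  obtain ⟨m, hm⟩ := hD β' β hβ' n
  refine ⟨m, fun t ht htD => ?_⟩
  have h3 := congrFun (hi'.trans hγ.symm) m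
  have h4 : (⟨t, ht⟩ : S) ∈ {t : S | (t : T) ∈ D m β'} := hm htD
  rw [h3] at h4
  exact h4

/-! ### Successors of cardinals of countable cofinality -/

theorem succ_power_aleph0_le_of_cof_le (hMRP : MRP.{u}) {κ : Cardinal.{u}} (hκ : ℵ₀ < κ)
    (hcof : κ.ord.cof ≤ ℵ₀) (h2 : 2 ^ ℵ₀ ≤ κ) (hpow : ∀ μ < κ, μ ^ ℵ₀ ≤ κ) :
    Order.succ κ ^ ℵ₀ ≤ Order.succ κ := by
  by_contra! hlt
  let T := (Order.succ κ).ord.ToType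
  have hT : IsSuccType T κ := isSuccType_toType hκ.le
  have := hT.uncountable
  obtain ⟨D₀, hD₀lt, hD₀mono, hD₀mem, hD₀⟩ := exists_covering_matrix hT hκ hcof
  let D : ℕ → T → Set T := fun n β => adherent (D₀ n β)
  have hDlt : ∀ n β, #(D n β) < κ := fun n β => mk_adherent_lt hκ.le (hD₀lt n β)
  have hDmono : ∀ β m n, m ≤ n → D m β ⊆ D n β := fun β m n h => adherent_mono (hD₀mono β h)
  have hDmem : ∀ β β', β' ≤ β → ∃ n, β' ∈ D n β := fun β β' h => by
    obtain ⟨n, hn⟩ := hD₀mem β β' h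
    exact ⟨n, subset_adherent _ hn⟩
  have hD : ∀ β β', β' ≤ β → ∀ n, ∃ m, D n β' ⊆ D m β := fun β β' h n => by
    obtain ⟨m, hm⟩ := hD₀ β β' h n
    exact ⟨m, adherent_mono hm⟩
  have hγ : ∀ S : Set T, ∃ γ, S.Countable → ∀ β n, ∃ m, ∀ t ∈ S, t ∈ D n β → t ∈ D m γ := by
    intro S
    by_cases hS : S.Countable
    · obtain ⟨γ, h⟩ := exists_capturing_column hT h2 D hD hS
      exact ⟨γ, fun _ => h⟩
    · exact ⟨Classical.arbitrary T, fun h => absurd h hS⟩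
  choose γ hγ using hγ
  have hJ : ∀ S : Set T, ∃ a, S.Countable → IsLUB S a := by
    intro S
    by_cases hS : S.Countable
    · obtain ⟨a, h⟩ := hT.exists_isLUB hS
      exact ⟨a, fun _ => h⟩
    · exact ⟨Classical.arbitrary T, fun h => absurd h hS⟩
  choose J hJ using hJ
  obtain ⟨c, hc⟩ := exists_ladder_fun T
  choose su hsu using hT.exists_gt
  -- The same `n` bounds `Y` by the ladder and names the entry its supremum avoids, so a set
  -- reaching higher on the ladder must avoid a larger entry.
  let Sig : Set T → Set (Set T) := fun S =>
    {Y | Y.Countable ∧ ∃ n, (∀ y ∈ Y, y < c S n) ∧ J Y ∉ D n (γ S)}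
  have hladder : ∀ S : Set T, S.Countable → S.Nonempty → (∀ a ∈ S, su a ∈ S) →
      Monotone (c S) ∧ (∀ n, c S n ∈ S) ∧ ∀ s ∈ S, ∃ n, s < c S n := fun S h1 h2 h3 =>
    hc S h1 h2 fun s hs => ⟨su s, h3 s hs, hsu s⟩
  have hopen : ∀ S, ∀ Y ∈ Sig S, ∃ x : Set T, x.Finite ∧ x ⊆ Y ∧
      ∀ Y', x ⊆ Y' → Y' ⊆ Y → Y' ∈ Sig S := by
    rintro S Y ⟨hYc, n, hYn, hYD⟩
    obtain ⟨γ₀, hγ₀, hint⟩ := exists_interval_of_notMem_adherent hYD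
    obtain ⟨y, hy, hγy⟩ : ∃ y ∈ Y, γ₀ < y := by
      by_contra! h
      exact ((hJ Y hYc).2 h).not_gt hγ₀
    refine ⟨{y}, Set.finite_singleton y, Set.singleton_subset_iff.2 hy, fun Y' h1 h2 =>
      ⟨hYc.mono h2, n, fun z hz => hYn z (h2 hz), ?_⟩⟩
    have hY' := hJ Y' (hYc.mono h2)
    exact hint _ (hγy.trans_le (hY'.1 (h1 rfl))) (hY'.2 fun z hz => (hJ Y hYc).1 (h2 hz))
  have hstat : ∀ f : Finset T → T, ∃ (Y : ℕ → T → Set T) (q : ℕ → T),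
      (∀ i t, (Y i t).Countable ∧ (Y i t).Infinite ∧
        ∀ s : Finset T, (∀ a ∈ s, a ∈ Y i t) → f s ∈ Y i t) ∧
      ∀ S : Set T, S.Countable → S.Nonempty → (∀ _ : ℕ, ∀ a ∈ S, ∀ _ ∈ S, su a ∈ S) →
        (∀ i, q i ∈ S) → ∃ i, ∃ t ∈ S, Y i t ∈ Sig S := by
    intro f
    choose Y hYβ hYc hYi hYf using fun β : T =>
      exists_countable_finset_closed f {β} (Set.countable_singleton β)
    -- The suprema of the closed sets `Y β` are unbounded, hence some countable family of them lies
    -- in no entry. The parameter `q` bounds that family, so one rung of the ladder of `S` works for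
    -- all of it.
    obtain ⟨b, hb⟩ := exists_uncovered hT hpow hlt D hDlt (α := fun β => J (Y β))
      fun β => ⟨β, (hJ _ (hYc β)).1 (hYβ β rfl)⟩
    obtain ⟨q, hq⟩ := hT.exists_forall_lt
      (hT.mk_le_of_countable (Set.countable_range fun i => J (Y (b i))))
    refine ⟨fun i _ => Y (b i), fun _ => q, fun i _ => ⟨hYc _, hYi _, hYf _⟩,
      fun S hS hne hG hqS => ?_⟩
    obtain ⟨-, hcS, hcof⟩ := hladder S hS hne fun a ha => hG 0 a ha a ha
    obtain ⟨n, hn⟩ := hcof q (hqS 0)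
    obtain ⟨i, hi⟩ := hb n (γ S)
    obtain ⟨t, ht⟩ := hne
    exact ⟨i, t, ht, hYc _, n, fun y hy => (((hJ _ (hYc _)).1 hy).trans_lt
      (hq _ ⟨i, rfl⟩)).trans hn, hi⟩
  obtain ⟨N, hN, hNmono, hNlim, hNSig⟩ :=
    reflection hMRP (fun _ a _ => su a) J Sig hopen hstat
  obtain ⟨δ, hδ⟩ := hT.exists_forall_omega_one_lt hκ fun ξ => J (N ξ)
  -- All the suprema lie below `δ`, so stationarily many fall into one entry of column `δ`.
  obtain ⟨n, hn⟩ := stationary_Iio_omega_one.exists_of_subset_iUnion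
    (fun n => {ξ | ξ < ω₁ ∧ J (N ξ) ∈ D n δ}) fun ξ hξ => by
      obtain ⟨n, hn⟩ := hDmem δ (J (N ξ)) (hδ ξ hξ).le
      exact Set.mem_iUnion.2 ⟨n, hξ, hn⟩
  have hF : ∀ a : Ordinal.{u}, ∃ b, a < ω₁ → b < ω₁ ∧ a < b ∧ J (N b) ∈ D n δ := by
    intro a
    by_cases ha : a < ω₁
    · obtain ⟨b, ⟨-, h1⟩, h2, h3⟩ := hn.exists_gt ha
      exact ⟨b, fun _ => ⟨h2, h3, h1⟩⟩
    · exact ⟨0, fun h => absurd h ha⟩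
  choose F hF using hF
  obtain ⟨ξ, hξ, hlim, hcl⟩ := exists_closed_lt_omega_one F fun a ha => (hF a ha).1
  obtain ⟨hNc, hNne, hNsu⟩ := hN ξ hξ
  obtain ⟨hcm, hcS, -⟩ := hladder (N ξ) hNc hNne fun a ha => hNsu 0 a ha a ha
  -- Inside N_ξ that entry is captured by entry `m` of the column attached to N_ξ.
  obtain ⟨m, hm⟩ := hγ (N ξ) hNc δ n
  obtain ⟨ν, hν, hνSig⟩ := hNSig ξ hξ hlim
  obtain ⟨η₀, hη₀, hcη⟩ := hNlim ξ hξ hlim _ (hcS m)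
  have hmax : max ν η₀ < ξ := max_lt hν hη₀
  obtain ⟨h1, h2, h3⟩ := hF (max ν η₀) (hmax.trans hξ)
  have h4 := hcl _ hmax
  obtain ⟨-, k, hk, hk'⟩ := hνSig _ ((le_max_left _ _).trans_lt h2) h4
  -- The earlier model contains rung `m` and lies below rung `k`, so m ≤ k. Its supremum, an element
  -- of N_ξ, then lies in the entry it should avoid.
  have h5 := hk _ ((hNmono _ _ ((le_max_right _ _).trans_lt h2) h1).1 hcη)
  have h6 : m ≤ k := by
    by_contra! h
    exact (hcm h.le).not_gt h5
  exact hk' (hDmono _ _ _ h6 (hm _ (hNmono _ _ h4 hξ).2 h3))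

/-! ### Coding subsets of ω by points of ω₂ -/

/-- Two continuous increasing sequences of countable sets with the same union agree on a club. -/
theorem exists_club_agree {T : Type u} {N N' : Ordinal.{u} → Set T} {w : Ordinal.{u} → T}
    (hw : ∀ a b, a < b → b < ω₁ → w a ≠ w b)
    (hc : ∀ ξ < ω₁, (N ξ).Countable) (hc' : ∀ ξ < ω₁, (N' ξ).Countable)
    (hmono : ∀ ξ η, ξ < η → η < ω₁ → N ξ ⊆ N η) (hmono' : ∀ ξ η, ξ < η → η < ω₁ → N' ξ ⊆ N' η)
    (hlim : ∀ ξ < ω₁, Order.IsSuccLimit ξ → ∀ t ∈ N ξ, ∃ η < ξ, t ∈ N η)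
    (hlim' : ∀ ξ < ω₁, Order.IsSuccLimit ξ → ∀ t ∈ N' ξ, ∃ η < ξ, t ∈ N' η)
    (hU : ∀ t, (∃ ξ < ω₁, t ∈ N ξ) ↔ ∃ ξ < ω₁, t ∈ N' ξ)
    (hwN : ∀ a < ω₁, ∃ ξ < ω₁, w a ∈ N ξ) :
    ∃ F : Ordinal.{u} → Ordinal.{u}, (∀ a < ω₁, F a < ω₁) ∧
      ∀ δ < ω₁, Order.IsSuccLimit δ → (∀ a < δ, F a < δ) →
        N δ = N' δ ∧ sInf {a | w a ∉ N δ} = δ := by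
  have hidx : ∀ t : T, ∃ ξ : Ordinal.{u}, ξ < ω₁ ∧ ((∃ ξ < ω₁, t ∈ N ξ) → t ∈ N ξ ∧ t ∈ N' ξ) := by
    intro t
    by_cases h : ∃ ξ < ω₁, t ∈ N ξ
    · obtain ⟨ξ, hξ, ht⟩ := id h
      obtain ⟨ξ', hξ', ht'⟩ := (hU t).1 h
      have h1 := max_lt hξ hξ'
      have h2 := isSuccLimit_omega_one.succ_lt h1
      exact ⟨_, h2, fun _ => ⟨hmono _ _ (Order.lt_succ_of_le (le_max_left _ _)) h2 ht,
        hmono' _ _ (Order.lt_succ_of_le (le_max_right _ _)) h2 ht'⟩⟩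
    · exact ⟨0, isSuccLimit_omega_one.bot_lt, fun h' => absurd h' h⟩
  choose idx hidx1 hidx2 using hidx
  have hF : ∀ a : Ordinal.{u}, ∃ b, a < ω₁ → b < ω₁ ∧ (∀ t ∈ N a, idx t < b) ∧
      (∀ t ∈ N' a, idx t < b) ∧ idx (w a) < b ∧ ∀ d < ω₁, w d ∈ N a → d < b := by
    intro a
    by_cases ha : a < ω₁
    · have h1 : {d : Ordinal.{u} | d < ω₁ ∧ w d ∈ N a}.Countable := by
        refine Set.MapsTo.countable_of_injOn (f := w) (t := N a) (fun d hd => hd.2) ?_ (hc a ha)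
        intro d hd d' hd' h
        rcases lt_trichotomy d d' with h1 | h1 | h1
        · exact absurd h (hw _ _ h1 hd'.1)
        · exact h1
        · exact absurd h.symm (hw _ _ h1 hd.1)
      obtain ⟨b, hb, hb'⟩ := exists_lt_omega_one_of_countable
        (s := idx '' (N a ∪ N' a ∪ {w a}) ∪ {d : Ordinal.{u} | d < ω₁ ∧ w d ∈ N a})
        (((((hc a ha).union (hc' a ha)).union (Set.countable_singleton _)).image idx).union h1) (by
          rintro _ (⟨t, -, rfl⟩ | h)
          exacts [hidx1 t, h.1])
      exact ⟨b, fun _ => ⟨hb, fun t ht => hb' _ (Or.inl ⟨t, Or.inl (Or.inl ht), rfl⟩),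
        fun t ht => hb' _ (Or.inl ⟨t, Or.inl (Or.inr ht), rfl⟩),
        hb' _ (Or.inl ⟨_, Or.inr rfl, rfl⟩), fun d hd hd' => hb' _ (Or.inr ⟨hd, hd'⟩)⟩⟩
    · exact ⟨0, fun h => absurd h ha⟩
  choose F hF using hF
  refine ⟨F, fun a ha => (hF a ha).1, fun δ hδ hl hcl => ⟨Set.Subset.antisymm ?_ ?_, ?_⟩⟩
  · intro t ht
    obtain ⟨η, hη, ht'⟩ := hlim δ hδ hl t ht
    exact hmono' _ _ (((hF η (hη.trans hδ)).2.1 t ht').trans (hcl η hη)) hδ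
      (hidx2 t ⟨δ, hδ, ht⟩).2
  · intro t ht
    obtain ⟨η, hη, ht'⟩ := hlim' δ hδ hl t ht
    exact hmono _ _ (((hF η (hη.trans hδ)).2.2.1 t ht').trans (hcl η hη)) hδ
      (hidx2 t ((hU t).2 ⟨δ, hδ, ht⟩)).1
  -- At closure points the trace of N_δ on the copy of ω₁ is exactly δ.
  · have h1 : ∀ a < δ, w a ∈ N δ := fun a ha =>
      hmono _ _ (((hF a (ha.trans hδ)).2.2.2.1).trans (hcl a ha)) hδ
        (hidx2 _ (hwN a (ha.trans hδ))).1
    have h2 : w δ ∉ N δ := by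
      intro h
      obtain ⟨η, hη, h'⟩ := hlim δ hδ hl _ h
      exact lt_asymm ((hF η (hη.trans hδ)).2.2.2.2 δ hδ h') (hcl η hη)
    refine le_antisymm (csInf_le' h2) (le_csInf ⟨δ, h2⟩ fun a ha => ?_)
    by_contra! h
    exact ha (h1 a h)

section coding

variable {T : Type u} [LinearOrder T]

/-- The sets which are low in the part `S ∩ W` of `S` and high in `S`, as measured by the ladder
system `c`. -/
def lowHigh (c : Set T → ℕ → T) (W S : Set T) : Set (Set T) :=
  {Y | ∃ n, (∀ y ∈ Y, y ∈ W → y < c (S ∩ W) n) ∧ ∃ y ∈ Y, c S n ≤ y}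

/-- The sets which are high in the part `S ∩ W` of `S` and low in `S`, as measured by the ladder
system `c`. -/
def highLow (c : Set T → ℕ → T) (W S : Set T) : Set (Set T) :=
  {Y | ∃ n, (∀ y ∈ Y, y < c S n) ∧ ∃ y ∈ Y, y ∈ W ∧ c (S ∩ W) n ≤ y}

/-- Compare the two witnessing rungs: whichever is smaller, its bound contradicts the point that is
high at the other. Thus one set cannot code two opposite answers. -/
theorem notMem_highLow_of_mem_lowHigh {c : Set T → ℕ → T} {W S Y : Set T} (h1 : Monotone (c S))
    (h2 : Monotone (c (S ∩ W))) (h : Y ∈ lowHigh c W S) : Y ∉ highLow c W S := by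
  rintro ⟨m, hm, y', hy', hW, hy'm⟩
  obtain ⟨n, hn, y, hy, hyn⟩ := h
  rcases le_total n m with h | h
  · exact ((hn y' hy' hW).trans_le (h2 h)).not_ge hy'm
  · exact ((hm y hy).trans_le (h1 h)).not_ge hyn

/-- `W` is a copy of ω₁ in ω₂. The mapping asks for low-high or high-low according to `A` at the
first element of `W` missing from the model. Passing that element to the next model puts all of `W`
in the union. Surjections from `W` onto initial segments then make the union an initial segment. -/
theorem exists_coding_chain (hMRP : MRP.{u}) [WellFoundedLT T] (hT : IsSuccType T ℵ₁)
    {w : Ordinal.{u} → T} (hw : ∀ a b, a < b → b < ω₁ → w a < w b)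
    {c : Set T → ℕ → T} (hc : ∀ S : Set T, S.Countable → S.Nonempty →
      (∀ s ∈ S, ∃ t ∈ S, s < t) → Monotone (c S) ∧ (∀ n, c S n ∈ S) ∧ ∀ s ∈ S, ∃ n, s < c S n)
    (A : Ordinal.{u} → Prop) :
    ∃ (N : Ordinal.{u} → Set T) (u : T), (∀ ξ < ω₁, (N ξ).Countable) ∧
      (∀ ξ η, ξ < η → η < ω₁ → N ξ ⊆ N η) ∧
      (∀ ξ < ω₁, Order.IsSuccLimit ξ → ∀ t ∈ N ξ, ∃ η < ξ, t ∈ N η) ∧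
      (∀ a < ω₁, ∃ ξ < ω₁, w a ∈ N ξ) ∧ (∀ t, (∃ ξ < ω₁, t ∈ N ξ) ↔ t < u) ∧
      (∀ ξ < ω₁, Monotone (c (N ξ)) ∧ Monotone (c (N ξ ∩ w '' Set.Iio ω₁))) ∧
      ∀ ξ < ω₁, Order.IsSuccLimit ξ → ∃ ν < ξ, ∀ η, ν < η → η < ξ →
        (A (sInf {a | w a ∉ N ξ}) → N η ∈ lowHigh c (w '' Set.Iio ω₁) (N ξ)) ∧
        (¬ A (sInf {a | w a ∉ N ξ}) → N η ∈ highLow c (w '' Set.Iio ω₁) (N ξ)) := by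
  have := hT.uncountable
  set W : Set T := w '' Set.Iio ω₁ with hWdef
  have hWcard : #W ≤ ℵ₁ := by
    have h1 : W ⊆ Set.range fun a : (ω₁ : Ordinal.{u}).ToType => w (Ordinal.ToType.mk.symm a) := by
      rintro _ ⟨a, ha, rfl⟩
      exact ⟨Ordinal.ToType.mk ⟨a, ha⟩, by simp⟩
    refine (Cardinal.mk_le_mk_of_subset h1).trans (Cardinal.mk_range_le.trans ?_)
    rw [Cardinal.mk_toType, Ordinal.card_omega]
  have hWbdd : ∀ Y : Set T, Y.Countable → ∃ e ∈ W, ∀ y ∈ Y, y ∈ W → y < e := by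
    intro Y hY
    have : ∀ t : T, ∃ a : Ordinal.{u}, a < ω₁ ∧ (t ∈ W → w a = t) := by
      intro t
      by_cases ht : t ∈ W
      · obtain ⟨a, ha, h⟩ := ht
        exact ⟨a, ha, fun _ => h⟩
      · exact ⟨0, isSuccLimit_omega_one.bot_lt, fun h => absurd h ht⟩
    choose idx h1 h2 using this
    obtain ⟨b, hb, hb'⟩ := exists_lt_omega_one_of_countable (hY.image idx)
      (by rintro _ ⟨t, -, rfl⟩; exact h1 t)
    refine ⟨w b, ⟨b, hb, rfl⟩, fun y hy hyW => ?_⟩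
    rw [← h2 y hyW]
    exact hw _ _ (hb' _ ⟨y, hy, rfl⟩) hb
  choose su hsu using hT.exists_gt
  have hsuW : ∀ t : T, ∃ t' ∈ W, t ∈ W → t < t' := fun t => by
    obtain ⟨e, he, h⟩ := hWbdd {t} (Set.countable_singleton t)
    exact ⟨e, he, h t rfl⟩
  choose suW hsuWmem hsuW using hsuW
  have hφ : ∀ t : T, ∃ φ : T → T, ∀ s < t, ∃ v ∈ W, φ v = s := by
    intro t
    have h1 : #(Set.Iio t) ≤ #W := by
      refine (hT.mk_Iio_le t).trans ?_
      have h2 : Function.Injective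
          fun a : (ω₁ : Ordinal.{u}).ToType =>
            (⟨w (Ordinal.ToType.mk.symm a), _, (Ordinal.ToType.mk.symm a).2, rfl⟩ : W) := by
        intro a b hab
        have hab' : w (Ordinal.ToType.mk.symm a) = w (Ordinal.ToType.mk.symm b) :=
          congrArg Subtype.val hab
        rcases lt_trichotomy a b with h | h | h
        · exact absurd hab' (hw _ _ (Ordinal.ToType.mk.symm.lt_iff_lt.2 h)
            (Ordinal.ToType.mk.symm b).2).ne
        · exact h
        · exact absurd hab' (hw _ _ (Ordinal.ToType.mk.symm.lt_iff_lt.2 h)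
            (Ordinal.ToType.mk.symm a).2).ne'
      have h3 := Cardinal.mk_le_of_injective h2
      rwa [Cardinal.mk_toType, Ordinal.card_omega] at h3
    obtain ⟨j⟩ := h1
    refine ⟨Function.extend (fun s => (j s : T)) Subtype.val id, fun s hs =>
      ⟨j ⟨s, hs⟩, (j _).2, ?_⟩⟩
    exact (Subtype.val_injective.comp j.injective).extend_apply Subtype.val id ⟨s, hs⟩
  choose φ hφ using hφ
  -- Operations 0 and 1 prevent last elements in S and S ∩ W, 2 makes S ∩ W nonempty, and the rest
  -- make the union downward closed.
  let G : ℕ → T → T → T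
    | 0, a, _ => su a
    | 1, a, _ => suW a
    | 2, _, _ => w 0
    | _ + 3, a, b => φ a b
  have hw0 : w 0 ∈ W := ⟨0, isSuccLimit_omega_one.bot_lt, rfl⟩
  have hladder : ∀ S : Set T, S.Countable → S.Nonempty →
      (∀ n, ∀ a ∈ S, ∀ b ∈ S, G n a b ∈ S) →
      (Monotone (c S) ∧ (∀ n, c S n ∈ S) ∧ ∀ s ∈ S, ∃ n, s < c S n) ∧
      (Monotone (c (S ∩ W)) ∧ (∀ n, c (S ∩ W) n ∈ S ∩ W) ∧
        ∀ s ∈ S ∩ W, ∃ n, s < c (S ∩ W) n) := by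
    rintro S hS ⟨s₀, hs₀⟩ hG
    exact ⟨hc S hS ⟨s₀, hs₀⟩ fun s hs => ⟨su s, hG 0 s hs s hs, hsu s⟩,
      hc (S ∩ W) (hS.mono Set.inter_subset_left) ⟨w 0, hG 2 _ hs₀ _ hs₀, hw0⟩ fun s hs =>
        ⟨suW s, ⟨hG 1 s hs.1 s hs.1, hsuWmem s⟩, hsuW s hs.2⟩⟩
  let o : Set T → Ordinal.{u} := fun S => sInf {a | w a ∉ S}
  let Sig : Set T → Set (Set T) := fun S =>
    {Y | (A (o S) → Y ∈ lowHigh c W S) ∧ (¬ A (o S) → Y ∈ highLow c W S)}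
  have hopen : ∀ S, ∀ Y ∈ Sig S, ∃ x : Set T, x.Finite ∧ x ⊆ Y ∧
      ∀ Y', x ⊆ Y' → Y' ⊆ Y → Y' ∈ Sig S := by
    rintro S Y ⟨h1, h2⟩
    by_cases hA : A (o S)
    · obtain ⟨n, hn, y, hy, hyn⟩ := h1 hA
      exact ⟨{y}, Set.finite_singleton y, Set.singleton_subset_iff.2 hy, fun Y' h3 h4 =>
        ⟨fun _ => ⟨n, fun z hz => hn z (h4 hz), y, h3 rfl, hyn⟩, fun h => absurd hA h⟩⟩
    · obtain ⟨n, hn, y, hy, hyn⟩ := h2 hA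
      exact ⟨{y}, Set.finite_singleton y, Set.singleton_subset_iff.2 hy, fun Y' h3 h4 =>
        ⟨fun h => absurd h hA, fun _ => ⟨n, fun z hz => hn z (h4 hz), y, h3 rfl, hyn⟩⟩⟩
  have hstat : ∀ f : Finset T → T, ∃ (Y : ℕ → T → Set T) (q : ℕ → T),
      (∀ i t, (Y i t).Countable ∧ (Y i t).Infinite ∧
        ∀ s : Finset T, (∀ a ∈ s, a ∈ Y i t) → f s ∈ Y i t) ∧
      ∀ S : Set T, S.Countable → S.Nonempty → (∀ n, ∀ a ∈ S, ∀ b ∈ S, G n a b ∈ S) →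
        (∀ i, q i ∈ S) → ∃ i, ∃ t ∈ S, Y i t ∈ Sig S := by
    intro f
    choose Y hYβ hYc hYi hYf using fun β : T =>
      exists_countable_finset_closed f {β} (Set.countable_singleton β)
    choose e heW he using fun β => hWbdd (Y β) (hYc β)
    -- For low-high: ℵ₂ many `β` but only ℵ₁ bounds in `W`, so unboundedly many closed sets share a
    -- bound `e₀` while containing points arbitrarily high in `T`.
    obtain ⟨e₀, he₀⟩ := hT.exists_unbounded_fiber hWcard fun β => (⟨e β, heW β⟩ : W)
    choose β hβ hβe using he₀
    -- For high-low: the closed sets attached to points of `W` are bounded together in `T`, yet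
    -- contain points arbitrarily high in `W`.
    obtain ⟨q, hq⟩ := hT.exists_forall_lt (mk_iUnion_le_of_le hT.aleph0_le hWcard
      (fun t : W => Y t) fun t => hT.mk_le_of_countable (hYc t))
    refine ⟨fun i t => if i = 0 then Y (β t) else Y t, fun i => if i = 0 then e₀ else q,
      fun i t => ?_, fun S hS hne hG hqS => ?_⟩
    · by_cases hi : i = 0
      · simpa only [if_pos hi] using ⟨hYc _, hYi _, hYf _⟩
      · simpa only [if_neg hi] using ⟨hYc _, hYi _, hYf _⟩
    · obtain ⟨⟨-, h1, h2⟩, -, h3, h4⟩ := hladder S hS hne hG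
      by_cases hA : A (o S)
      · obtain ⟨n, hn⟩ := h4 e₀ ⟨by simpa using hqS 0, e₀.2⟩
        refine ⟨0, c S n, h1 n, fun _ => ⟨n, fun y hy hyW => ?_, β (c S n), hYβ _ rfl, hβ _⟩,
          fun h => absurd hA h⟩
        have h5 := he _ y hy hyW
        have h6 : e (β (c S n)) = e₀ := congrArg Subtype.val (hβe (c S n))
        rw [h6] at h5
        exact h5.trans hn
      · obtain ⟨n, hn⟩ := h2 q (by simpa using hqS 1)
        exact ⟨1, c (S ∩ W) n, (h3 n).1, fun h => absurd h hA, fun _ =>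
          ⟨n, fun y hy => (hq y (Set.mem_iUnion.2 ⟨⟨_, (h3 n).2⟩, hy⟩)).trans hn,
            c (S ∩ W) n, hYβ _ rfl, (h3 n).2, le_rfl⟩⟩
  obtain ⟨N, hN, hNmono, hNlim, hNSig⟩ :=
    reflection hMRP G (fun S => w (o S)) Sig hopen hstat
  have hwN : ∀ a < ω₁, ∃ ξ < ω₁, w a ∈ N ξ := by
    intro a
    induction a using WellFoundedLT.induction with
    | ind a ih =>
      intro ha
      have h1 : ∀ b, ∃ ξ : Ordinal.{u}, ξ < ω₁ ∧ (b < a → w b ∈ N ξ) := by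
        intro b
        by_cases hb : b < a
        · obtain ⟨ξ, h, h'⟩ := ih b hb (hb.trans ha)
          exact ⟨ξ, h, fun _ => h'⟩
        · exact ⟨0, isSuccLimit_omega_one.bot_lt, fun h => absurd h hb⟩
      choose i hi hi' using h1
      obtain ⟨ξ, hξ, hξ'⟩ := exists_lt_omega_one_of_countable
        ((countable_Iio_of_lt_omega_one ha).image i) (by rintro _ ⟨b, -, rfl⟩; exact hi b)
      have h2 : ∀ b < a, w b ∈ N ξ := fun b hb =>
        (hNmono _ _ (hξ' _ ⟨b, hb, rfl⟩) hξ).1 (hi' b hb)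
      by_cases h3 : w a ∈ N ξ
      · exact ⟨ξ, hξ, h3⟩
      · have h4 : o (N ξ) = a := by
          refine le_antisymm (csInf_le' h3) (le_csInf ⟨a, h3⟩ fun b hb => ?_)
          by_contra! h
          exact hb (h2 b h)
        have h5 := isSuccLimit_omega_one.succ_lt hξ
        have h6 := (hNmono ξ _ (Order.lt_succ ξ) h5).2
        rw [h4] at h6
        exact ⟨_, h5, h6⟩
  have hdown : ∀ t s, (∃ ξ < ω₁, t ∈ N ξ) → s < t → ∃ ξ < ω₁, s ∈ N ξ := by
    rintro t s ⟨ξ, hξ, ht⟩ hst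
    obtain ⟨v, ⟨a, ha, rfl⟩, rfl⟩ := hφ t s hst
    obtain ⟨η, hη, hv⟩ := hwN a ha
    have h1 := isSuccLimit_omega_one.succ_lt (max_lt hξ hη)
    exact ⟨_, h1, (hN _ h1).2.2 3 _ ((hNmono _ _ (Order.lt_succ_of_le (le_max_left _ _)) h1).1 ht)
      _ ((hNmono _ _ (Order.lt_succ_of_le (le_max_right _ _)) h1).1 hv)⟩
  have hU : ∃ u, ∀ t, (∃ ξ < ω₁, t ∈ N ξ) ↔ t < u := by
    obtain ⟨b, hb⟩ := hT.exists_forall_lt (mk_iUnion_le_of_le hT.aleph0_le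
      (ι := (ω₁ : Ordinal.{u}).ToType) (by rw [Cardinal.mk_toType, Ordinal.card_omega])
      (fun a => N (Ordinal.ToType.mk.symm a)) fun a =>
        hT.mk_le_of_countable (hN _ (Ordinal.ToType.mk.symm a).2).1)
    have hne : {t : T | ¬ ∃ ξ < ω₁, t ∈ N ξ}.Nonempty := by
      refine ⟨b, ?_⟩
      rintro ⟨ξ, hξ, h⟩
      exact lt_irrefl b (hb b (Set.mem_iUnion.2 ⟨Ordinal.ToType.mk ⟨ξ, hξ⟩, by simpa using h⟩))
    refine ⟨wellFounded_lt.min _ hne, fun t => ⟨fun ht => ?_, fun ht => ?_⟩⟩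
    · by_contra h
      rcases (not_lt.1 h).lt_or_eq with h | h
      · exact wellFounded_lt.min_mem _ hne (hdown _ _ ht h)
      · exact wellFounded_lt.min_mem _ hne (h ▸ ht)
    · by_contra h
      exact wellFounded_lt.not_lt_min {t : T | ¬ ∃ ξ < ω₁, t ∈ N ξ} h ht
  obtain ⟨u, hu⟩ := hU
  refine ⟨N, u, fun ξ hξ => (hN ξ hξ).1, fun ξ η h h' => (hNmono ξ η h h').1, hNlim, hwN, hu,
    fun ξ hξ => ?_, hNSig⟩
  have := hladder _ (hN ξ hξ).1 (hN ξ hξ).2.1 (hN ξ hξ).2.2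
  exact ⟨this.1.1, this.2.1⟩

end coding

theorem two_power_aleph0_le (hMRP : MRP.{u}) : (2 : Cardinal.{u}) ^ (ℵ₀ : Cardinal.{u}) ≤ ℵ_ 2 := by
  have h2 : (ℵ_ 2 : Cardinal.{u}) = Order.succ ℵ₁ := by
    rw [Cardinal.succ_aleph, one_add_one_eq_two]
  rw [h2]
  let T := (Order.succ (ℵ₁ : Cardinal.{u})).ord.ToType
  have hT : IsSuccType T ℵ₁ := isSuccType_toType (Cardinal.aleph0_le_aleph 1)
  have := hT.uncountable
  obtain ⟨w, hw⟩ : ∃ w : Ordinal.{u} → T, ∀ a b, a < b → b < ω₁ → w a < w b := by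
    have h1 : ω₁ ≤ (Order.succ (ℵ₁ : Cardinal.{u})).ord := by
      rw [← Cardinal.ord_aleph]
      exact Cardinal.ord_le_ord.2 (Order.le_succ _)
    refine ⟨fun a => if h : a < (Order.succ (ℵ₁ : Cardinal.{u})).ord then
      Ordinal.ToType.mk ⟨a, h⟩ else Classical.arbitrary T, fun a b hab hb => ?_⟩
    beta_reduce
    rw [dif_pos ((hab.trans hb).trans_le h1), dif_pos (hb.trans_le h1)]
    exact Ordinal.ToType.mk.lt_iff_lt.2 hab
  obtain ⟨c, hc⟩ := exists_ladder_fun T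
  obtain ⟨h, hh⟩ := exists_stationary_fibers.{u}
  choose N u hNc hNmono hNlim hwN hu hladder hNSig using fun r : Set ℕ =>
    exists_coding_chain hMRP hT hw hc fun a => h a ∈ r
  have key : ∀ r r' : Set ℕ, u r = u r' → r ⊆ r' := by
    intro r r' hrr n hn
    by_contra hn'
    obtain ⟨F, hF, hFN⟩ := exists_club_agree (fun a b h1 h2 => (hw a b h1 h2).ne) (hNc r) (hNc r')
      (hNmono r) (hNmono r') (hNlim r) (hNlim r')
      (fun t => by rw [hu r t, hu r' t, hrr]) (hwN r)
    -- The chains for r and r' agree at arbitrarily late stages, so `δ` below can be taken a limit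
    -- of such stages inside the piece of index `n`.
    have hF' : ∀ a : Ordinal.{u}, ∃ b, a < ω₁ → b < ω₁ ∧ a < b ∧ F a < b ∧ N r b = N r' b := by
      intro a
      by_cases ha : a < ω₁
      · obtain ⟨δ, h1, h2, h3⟩ := exists_closed_lt_omega_one (fun b => max a (max (F a) (F b)))
          fun b hb => max_lt ha (max_lt (hF a ha) (hF b hb))
        have h4 := h3 0 h2.bot_lt
        exact ⟨δ, fun _ => ⟨h1, (le_max_left _ _).trans_lt h4,
          ((le_max_left _ _).trans (le_max_right _ _)).trans_lt h4, (hFN δ h1 h2 fun b hb =>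
            ((le_max_right _ _).trans (le_max_right _ _)).trans_lt (h3 b hb)).1⟩⟩
      · exact ⟨0, fun h => absurd h ha⟩
    choose F' hF' using hF'
    obtain ⟨δ, hδn, hδ, hl, hcl⟩ := hh n F' fun a ha => (hF' a ha).1
    obtain ⟨h1, h2⟩ := hFN δ hδ hl fun a ha => ((hF' a (ha.trans hδ)).2.2.1).trans (hcl a ha)
    obtain ⟨ν, hν, hνS⟩ := hNSig r δ hδ hl
    obtain ⟨ν', hν', hνS'⟩ := hNSig r' δ hδ hl
    have h3 := max_lt hν hν'
    obtain ⟨h4, h5, -, h6⟩ := hF' (max ν ν') (h3.trans hδ)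
    have h7 := hcl _ h3
    -- One common set before stage `δ` is low-high on behalf of r and high-low on behalf of r', with
    -- respect to the same N_δ.
    have h8 := (hνS _ ((le_max_left _ _).trans_lt h5) h7).1
    have h9 := (hνS' _ ((le_max_right _ _).trans_lt h5) h7).2
    rw [h2, hδn] at h8
    rw [← h1, h2, hδn, ← h6] at h9
    exact notMem_highLow_of_mem_lowHigh (hladder r δ hδ).1 (hladder r δ hδ).2 (h8 hn) (h9 hn')
  have hinj : Function.Injective u := fun r r' hrr =>
    Set.Subset.antisymm (key r r' hrr) (key r' r hrr.symm)
  have h3 := Cardinal.lift_mk_le_lift_mk_of_injective hinj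
  rw [hT.mk_eq, Cardinal.mk_set] at h3
  simpa using h3

/-! ### The induction -/

/-- Uncountable cofinality bounds every ω-sequence, so l^ℵ₀ is counted by `l` many sets of sequences
below a fixed point. -/
theorem power_aleph0_le_of_cof {l : Cardinal.{u}} (hl : ℵ₀ ≤ l) (hcof : ℵ₀ < l.ord.cof)
    (h : ∀ μ < l, μ ^ ℵ₀ ≤ l) : l ^ ℵ₀ ≤ l := by
  let T := l.ord.ToType
  have hT : #T = l := Cardinal.mk_ord_toType l
  have h1 : #(ℕ → T) = l ^ ℵ₀ := by
    rw [Cardinal.mk_pi, Cardinal.prod_const]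
    simp [hT]
  have h2 : (Set.univ : Set (ℕ → T)) ⊆ ⋃ t : T, {x : ℕ → T | ∀ i, x i ∈ Set.Iio t} := by
    intro x _
    have hx : ¬ IsCofinal (Set.range x) := by
      intro hx
      have h3 := Order.cof_le hx
      rw [Ordinal.cof_toType] at h3
      exact (hcof.trans_le h3).not_ge
        (Cardinal.le_aleph0_iff_set_countable.2 (Set.countable_range x))
    simp only [IsCofinal] at hx
    push Not at hx
    obtain ⟨t, ht⟩ := hx
    exact Set.mem_iUnion.2 ⟨t, fun i => ht _ ⟨i, rfl⟩⟩
  rw [← h1, ← Cardinal.mk_univ]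
  refine (Cardinal.mk_le_mk_of_subset h2).trans (mk_iUnion_le_of_le hl hT.le _ fun t => ?_)
  have h4 : #{x : ℕ → T | ∀ i, x i ∈ Set.Iio t} = #(ℕ → Set.Iio t) :=
    Cardinal.mk_congr (Equiv.subtypePiEquivPi (p := fun _ s => s ∈ Set.Iio t))
  have h5 := Cardinal.mk_Iio_lt t (by simp [T])
  rw [hT] at h5
  rw [h4, Cardinal.mk_pi, Cardinal.prod_const]
  simpa using h _ h5

theorem power_aleph0_le (hMRP : MRP.{u}) (l : Cardinal.{u}) (hl : ℵ_ 2 ≤ l)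
    (hcof : ℵ₀ < l.ord.cof) : l ^ (ℵ₀ : Cardinal.{u}) ≤ l := by
  induction l using WellFoundedLT.induction with
  | ind l ih =>
    have h2 : (ℵ_ 2 : Cardinal.{u}) = Order.succ ℵ₁ := by
      rw [Cardinal.succ_aleph, one_add_one_eq_two]
    have hcont := two_power_aleph0_le hMRP
    have hl0 : ℵ₀ ≤ l := (Cardinal.aleph0_le_aleph 2).trans hl
    -- The induction hypothesis is applied at μ⁺, which is regular even when μ has countable
    -- cofinality.
    have hsucc : ∀ μ, ℵ₁ ≤ μ → Order.succ μ < l → μ ^ ℵ₀ < l := by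
      intro μ hμ hμl
      have h3 : (Order.succ μ).IsRegular :=
        Cardinal.isRegular_succ ((Cardinal.aleph0_le_aleph 1).trans hμ)
      refine lt_of_le_of_lt ((Cardinal.power_le_power_right (Order.le_succ μ)).trans
        (ih _ hμl (h2 ▸ Order.succ_le_succ hμ) ?_)) hμl
      rw [h3.cof_ord]
      exact (Cardinal.aleph0_lt_aleph_one.trans_le hμ).trans (Order.lt_succ μ)
    have hsmall : ∀ μ ≤ (ℵ₁ : Cardinal.{u}), μ ^ ℵ₀ ≤ ℵ_ 2 := by
      intro μ hμ
      refine le_trans ?_ hcont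
      refine (Cardinal.power_le_power_right
        (hμ.trans (Cardinal.aleph_one_le_continuum.trans_eq Cardinal.two_power_aleph0.symm))).trans ?_
      rw [← Cardinal.power_mul, Cardinal.aleph0_mul_aleph0]
    by_cases hlim : ∀ μ < l, Order.succ μ < l
    · refine power_aleph0_le_of_cof hl0 hcof fun μ hμ => ?_
      rcases le_total μ ℵ₁ with h | h
      · exact (hsmall μ h).trans hl
      · exact (hsucc μ h (hlim μ hμ)).le
    · push Not at hlim
      obtain ⟨κ, hκ, hκ'⟩ := hlim
      obtain rfl : l = Order.succ κ := le_antisymm hκ' (Order.succ_le_of_lt hκ)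
      have h1κ : ℵ₁ ≤ κ := by
        rw [h2] at hl
        exact Order.succ_le_succ_iff.1 hl
      have h0κ : ℵ₀ < κ := Cardinal.aleph0_lt_aleph_one.trans_le h1κ
      have hof : κ ^ ℵ₀ ≤ Order.succ κ → Order.succ κ ^ ℵ₀ ≤ Order.succ κ := fun h =>
        power_aleph0_le_of_cof hl0 hcof fun μ hμ =>
          (Cardinal.power_le_power_right (Order.lt_succ_iff.1 hμ)).trans h
      rcases h1κ.eq_or_lt with rfl | h1κ'
      · exact hof ((hsmall _ le_rfl).trans hl)
      · have h2κ : ℵ_ 2 ≤ κ := by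
          rw [h2]
          exact Order.succ_le_of_lt h1κ'
        by_cases hκcof : ℵ₀ < κ.ord.cof
        · exact hof ((ih κ hκ h2κ hκcof).trans (Order.le_succ κ))
        -- The only successor case needing reflection: κ^ℵ₀ itself is not controlled by the
        -- induction when κ has countable cofinality.
        · refine succ_power_aleph0_le_of_cof_le hMRP h0κ (not_lt.1 hκcof) (hcont.trans h2κ)
            fun μ hμ => ?_
          rcases le_total μ ℵ₁ with h | h
          · exact (hsmall μ h).trans h2κ
          · exact Order.lt_succ_iff.1 (hsucc μ h ((Order.succ_le_of_lt hμ).trans_lt hκ))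

end MRPFormal

theorem theorem1 (hMRP : MRPFormal.MRP.{u}) (l : Cardinal.{u}) (hl : ℵ_ 2 ≤ l)
    (hcof : ℵ₀ < l.ord.cof) : l ^ (ℵ₀ : Cardinal.{u}) = l :=
  le_antisymm (MRPFormal.power_aleph0_le hMRP l hl hcof)
    (Cardinal.self_le_power l Cardinal.one_le_aleph0)
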